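/- Let $n\ge 1$, let $\Omega\subset\mathbb R^n$ be open, and let $u:\Omega\to\mathbb R$ be harmonic, $\Delta u=0$ in $\Omega$. Let $f:\mathbb R^n\to\mathbb R$ be convex, symmetric (invariant under permutations of its arguments) and homogeneous of degree one, i.e. $f(t\lambda)=t f(\lambda)$ for all $t>0$, $\lambda\in\mathbb R^n$. For $x\in\Omega$ set $w(x)=f(\lambda_1,\dots,\lambda_n)$, where $\lambda_1,\dots,\lambda_n$ are the eigenvalues of $D^2u(x)$ counted with multiplicity. Then $w$ is continuous in $\Omega$ and $$w\,\Delta w\ \ge\ \frac 2n\,|\nabla w|^2\qquad\text{in }\Omega$$ in the viscosity sense; that is, for every $x\in\Omega$ and every $\varphi$ of class $C^2$ near $x$ with $\varphi(x)=w(x)$ and $\varphi\ge w$ near $x$, one has $w(x)\,\Delta\varphi(x)\ge\frac2n|\nabla\varphi(x)|^2$. If moreover $n\ge 2$ and $u$ is homogeneous of degree one (i.e. $u(tx)=t\,u(x)$ whenever $t>0$ and $x,tx\in\Omega$), then $$w\,\Delta w\ \ge\ \frac{2}{n-1}\,|\nabla w|^2+2\,\frac{n-2}{n-1}\,\frac{w^2}{|x|^2}\qquad\text{in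 }\Omega\setminus\{0\}$$ in the viscosity sense, i.e. with $\nabla w,\Delta w$ replaced by $\nabla\varphi,\Delta\varphi$ at $x$ for every $C^2$ function $\varphi$ touching $w$ from above at $x\in\Omega\setminus\{0\}$. -/

import Mathlib

open scoped Topology Laplacian Gradient

noncomputable section

namespace HarmonicHessian

/-- Euclidean space `ℝⁿ`. -/
abbrev E (n : ℕ) : Type := EuclideanSpace ℝ (Fin n)

/-- The Hessian matrix `D²u(x) = (∂ᵢ∂ⱼ u(x))ᵢⱼ`. -/
def hessian {n : ℕ} (u : E n → ℝ) (x : E n) : Matrix (Fin n) (Fin n) ℝ :=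
  Matrix.of fun i j => iteratedFDeriv ℝ 2 u x
    ![EuclideanSpace.basisFun (Fin n) ℝ i, EuclideanSpace.basisFun (Fin n) ℝ j]

/-- The Hessian of a function that is `C²` near `x` is a symmetric matrix. -/
theorem hessian_isHermitian {n : ℕ} {u : E n → ℝ} {x : E n} (hu : ContDiffAt ℝ 2 u x) :
    (hessian u x).IsHermitian := by
  have h : IsSymmSndFDerivAt ℝ u x := hu.isSymmSndFDerivAt (by simp)
  ext i j
  simp only [hessian, Matrix.conjTranspose_apply, Matrix.of_apply, star_trivial,
    iteratedFDeriv_two_apply]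
  exact h _ _

open Classical in
/-- The eigenvalues `(λ₁, …, λₙ)` of a real symmetric matrix, with multiplicity (the value at a
matrix that is not symmetric is irrelevant). -/
def eigenvalues {n : ℕ} (A : Matrix (Fin n) (Fin n) ℝ) : Fin n → ℝ :=
  if hA : A.IsHermitian then hA.eigenvalues else 0

/-- The function `w = F(D²u) = f(λ₁, …, λₙ)`, where `λ₁, …, λₙ` are the eigenvalues of `D²u`. -/
def hessianFunction {n : ℕ} (f : (Fin n → ℝ) → ℝ) (u : E n → ℝ) (x : E n) : ℝ :=
  f (eigenvalues (hessian u x))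

/-- `f` is invariant under permutations of its arguments. -/
def IsSymmetricFun {n : ℕ} (f : (Fin n → ℝ) → ℝ) : Prop :=
  ∀ (σ : Equiv.Perm (Fin n)) (l : Fin n → ℝ), f (l ∘ σ) = f l

/-- `g` is (positively) homogeneous of degree one on `S`: `g (t x) = t g x` for every `t > 0`
and every `x` such that `x` and `t x` both lie in `S`. -/
def IsHomogeneousOneOn {V : Type*} [AddCommGroup V] [Module ℝ V] (g : V → ℝ) (S : Set V) : Prop :=
  ∀ x ∈ S, ∀ t : ℝ, 0 < t → t • x ∈ S → g (t • x) = t * g x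

/-- The relation `P (x, w, ∇w, Δw)`, a differential inequality of subsolution type (it bounds `Δw`
from below), holds in the viscosity sense in `Ω`: `w` is continuous in `Ω` and, whenever a `C²`
function `φ` touches `w` from above at a point `x ∈ Ω`, the relation holds at `x` with the
derivatives of `w` replaced by those of `φ`. -/
def HoldsInViscositySense {n : ℕ} (Ω : Set (E n)) (w : E n → ℝ)
    (P : E n → ℝ → E n → ℝ → Prop) : Prop :=
  ContinuousOn w Ω ∧
    ∀ x ∈ Ω, ∀ φ : E n → ℝ, ContDiffAt ℝ 2 φ x → φ x = w x → (∀ᶠ y in 𝓝 x, w y ≤ φ y) →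
      P x (w x) (∇ φ x) (Δ φ x)

end HarmonicHessian

end

/-! At a point `x`, take an orthonormal eigenbasis `e` of D²u with eigenvalues `μ`, and a
subgradient `p` of `f` at `μ`. By Schur–Horn, Σ pᵢ D²u(qᵢ,qᵢ) ≤ w for every orthonormal frame `q`,
with equality at `x` for `q = e`. Rotating the frame as exp(tB)e along a line through `x` therefore
gives smooth minorants of `w`, and `φ` touches these from above too.

Write T for the third derivatives in the basis `e` and sᵢⱼ = (pᵢ-pⱼ)/(μᵢ-μⱼ), which is nonnegative
because `f` is symmetric. First derivatives give ∂ₖφ = Σ pᵢ Tᵢᵢₖ. The best skew B in each direction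
eₖ, summed over k, gives Δφ ≥ Σ sᵢⱼ Tᵢⱼₖ², the fourth-order terms cancelling by harmonicity
(`touching_inequality`). Since μ and Tᵢᵢₗ have zero trace in i, a weighted Cauchy–Schwarz bounds
(∂ₗφ)² by n·w·Σᵢ sᵢₗ Tᵢᵢₗ². The total symmetry of T makes these diagonal terms occur twice in the
bound for Δφ, hence the constant 2/n (`two_mul_sum_sq_le`).

For homogeneous `u`, the position vector is a null direction of D²u, and contracting D³u with it
gives -D²u. Removing that direction leaves the same algebra in dimension n-1, and the removed terms
equal 2w/|x|² (`sum_slope_eq_erase`).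

Four derivatives of `u` are needed, so harmonic functions are first shown to be smooth. -/

noncomputable section

namespace HarmonicHessian

open MeasureTheory

/-! ### Smoothness of harmonic functions. -/

/-- A smooth radial mollifier `η` together with a compactly supported `Θ` such that
`∇Θ(y) = η(y) y`. -/
theorem exists_radial_mollifier (n : ℕ) : ∃ η Θ : E n → ℝ, ContDiff ℝ (⊤ : ℕ∞) η ∧
    (∀ y, 1 ≤ ‖y‖ → η y = 0) ∧ (∀ y, 1 ≤ ‖y‖ → Θ y = 0) ∧
    (∀ y, HasFDerivAt Θ (η y • innerSL ℝ y) y) ∧ 0 < ∫ y, η y := by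
  let h : ContDiffBump (0 : ℝ) := ⟨1 / 2, 1, by norm_num, by norm_num⟩
  have h0 : ∀ s : ℝ, 1 ≤ s → h s = 0 := fun s hs =>
    h.zero_of_le_dist (by simpa [h] using hs.trans (le_abs_self s))
  have hη : ContDiff ℝ (⊤ : ℕ∞) fun y : E n => h (‖y‖ ^ 2) :=
    h.contDiff.comp (contDiff_norm_sq ℝ)
  have hη0 : ∀ y : E n, 1 ≤ ‖y‖ → h (‖y‖ ^ 2) = 0 := fun y hy => h0 _ (one_le_pow₀ hy)
  -- Starting the primitive at 1 makes Θ vanish outside the unit ball; the factor 1/2 cancels the 2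
  -- in ∇|y|² = 2y.
  refine ⟨fun y => h (‖y‖ ^ 2), fun y => (1 / 2) * ∫ t in (1 : ℝ)..(‖y‖ ^ 2), h t, hη, hη0,
    ?_, ?_, ?_⟩
  · intro y hy
    have h1 : (1 : ℝ) ≤ ‖y‖ ^ 2 := one_le_pow₀ hy
    have : ∫ t in (1 : ℝ)..(‖y‖ ^ 2), h t = ∫ t in (1 : ℝ)..(‖y‖ ^ 2), (0 : ℝ) := by
      refine intervalIntegral.integral_congr fun t ht => ?_
      rw [Set.uIcc_of_le h1] at ht
      exact h0 t ht.1
    simp [this]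
  · intro y
    have h1 : HasDerivAt (fun s : ℝ => ∫ t in (1 : ℝ)..s, h t) (h (‖y‖ ^ 2)) (‖y‖ ^ 2) :=
      intervalIntegral.integral_hasDerivAt_right (h.continuous.intervalIntegrable _ _)
        h.continuous.stronglyMeasurable.stronglyMeasurableAtFilter h.continuous.continuousAt
    have h2 := (h1.comp_hasFDerivAt y (hasStrictFDerivAt_norm_sq y).hasFDerivAt).const_mul (1 / 2)
    convert! h2 using 1
    ext v
    simp
    ring
  · refine Continuous.integral_pos_of_hasCompactSupport_nonneg_nonzero (x := 0) hη.continuous ?_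
      (fun y => h.nonneg) ?_
    · exact HasCompactSupport.of_support_subset_isCompact (isCompact_closedBall (0 : E n) 1)
        fun y hy => by
          by_contra hc
          exact hy (hη0 y (by simpa using (not_le.1 (by simpa using hc)).le))
    · have : h 0 = 1 := h.one_of_mem_closedBall (by simp [h])
      simp [this]

variable {n : ℕ}

theorem laplacian_eq_sum_fderiv (e : OrthonormalBasis (Fin n) ℝ (E n)) (u : E n → ℝ) (x : E n) :
    Δ u x = ∑ i, fderiv ℝ (fderiv ℝ u) x (e i) (e i) := by
  rw [InnerProductSpace.laplacian_eq_iteratedFDeriv_orthonormalBasis u e]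
  simp [iteratedFDeriv_two_apply]

theorem integrable_of_zero_outside_ball {g : E n → ℝ} (hg : Continuous g)
    (h0 : ∀ y, 1 ≤ ‖y‖ → g y = 0) : Integrable g := by
  refine hg.integrable_of_hasCompactSupport
    (HasCompactSupport.of_support_subset_isCompact (isCompact_closedBall (0 : E n) 1) fun y hy => ?_)
  by_contra hc
  exact hy (h0 y (by simpa using (not_le.1 (by simpa using hc)).le))

/-- The weighted averages `∫ U(x - εy) η(y) dy` of a harmonic function do not depend on `ε`. -/
theorem hasDerivAt_radial_average {η Θ : E n → ℝ} (hη : ContDiff ℝ (⊤ : ℕ∞) η)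
    (hη0 : ∀ y, 1 ≤ ‖y‖ → η y = 0) (hΘ0 : ∀ y, 1 ≤ ‖y‖ → Θ y = 0)
    (hΘ : ∀ y, HasFDerivAt Θ (η y • innerSL ℝ y) y) {U : E n → ℝ} (hU : ContDiff ℝ 2 U)
    (hUc : HasCompactSupport U) (x : E n) (ε : ℝ)
    (hΔ : ∀ y, ‖y‖ < 1 → Δ U (x - ε • y) = 0) :
    HasDerivAt (fun t : ℝ => ∫ y, U (x - t • y) * η y) 0 ε := by
  have hηc := hη.continuous
  have hUC := hU.continuous
  have hU1 : ContDiff ℝ 1 (fderiv ℝ U) := hU.fderiv_right (by norm_num)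
  have hU1C := hU1.continuous
  have hU2C : Continuous (fderiv ℝ (fderiv ℝ U)) := hU1.continuous_fderiv (by norm_num)
  have hUd : Differentiable ℝ U := hU.differentiable (by norm_num)
  have hU1d : Differentiable ℝ (fderiv ℝ U) := hU1.differentiable (by norm_num)
  have hΘd : Differentiable ℝ Θ := fun y => (hΘ y).differentiableAt
  have hΘC := hΘd.continuous
  obtain ⟨C, hC⟩ := (hUc.fderiv (𝕜 := ℝ)).exists_bound_of_continuous hU1C
  have key := hasDerivAt_integral_of_dominated_loc_of_deriv_le (μ := (volume : Measure (E n)))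
    (𝕜 := ℝ) (F := fun (t : ℝ) y => U (x - t • y) * η y)
    (F' := fun (t : ℝ) y => -(fderiv ℝ U (x - t • y) y) * η y)
    (bound := fun y => C * ‖y‖ * |η y|) (x₀ := ε) (s := Set.univ) Filter.univ_mem
    (Filter.Eventually.of_forall fun t => by
      refine Continuous.aestronglyMeasurable ?_
      fun_prop)
    (integrable_of_zero_outside_ball (by fun_prop) fun y hy => by simp [hη0 y hy])
    (by
      refine Continuous.aestronglyMeasurable ?_
      fun_prop)
    (Filter.Eventually.of_forall fun y t _ => by
      rw [norm_mul, norm_neg, Real.norm_eq_abs (η y)]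
      gcongr
      exact ((fderiv ℝ U (x - t • y)).le_opNorm y).trans (by gcongr; exact hC _))
    (integrable_of_zero_outside_ball (by fun_prop) fun y hy => by simp [hη0 y hy])
    (Filter.Eventually.of_forall fun y t _ => by
      have h1 : HasDerivAt (fun t : ℝ => x - t • y) (-y) t := by
        simpa using ((hasDerivAt_id t).smul_const y).const_sub x
      have h2 := ((hUd (x - t • y)).hasFDerivAt.comp_hasDerivAt t h1).mul_const (η y)
      simpa using h2)
  -- Since η(y)y = ∇Θ(y), integration by parts turns this integral into -ε ∫ ΔU(x-εy) Θ(y) dy, which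
  -- is zero.
  suffices hz : ∫ y, -(fderiv ℝ U (x - ε • y) y) * η y = 0 by
    have h := key.2
    rw [hz] at h
    exact h
  let e := EuclideanSpace.basisFun (Fin n) ℝ
  have hΘf : ∀ y v, fderiv ℝ Θ y v = η y * inner ℝ y v := fun y v => by
    rw [(hΘ y).fderiv]; simp
  have hf : ∀ i y, HasFDerivAt (fun y => fderiv ℝ U (x - ε • y) (e i))
      (-(ε • (fderiv ℝ (fderiv ℝ U) (x - ε • y)).flip (e i))) y := fun i y => by
    have h1 : HasFDerivAt (fun y : E n => x - ε • y) (-(ε • ContinuousLinearMap.id ℝ (E n))) y :=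
      ((hasFDerivAt_id y).const_smul ε).const_sub x
    have h2 := ((hU1d (x - ε • y)).hasFDerivAt.comp y h1).clm_apply (hasFDerivAt_const (e i) y)
    convert! h2 using 1
    ext v
    simp
  have hparts : ∀ i, ∫ y, fderiv ℝ U (x - ε • y) (e i) * fderiv ℝ Θ y (e i)
      = ∫ y, ε * (fderiv ℝ (fderiv ℝ U) (x - ε • y) (e i) (e i) * Θ y) := fun i => by
    rw [integral_mul_fderiv_eq_neg_fderiv_mul_of_integrable, ← integral_neg]
    · congr 1
      ext y
      rw [(hf i y).fderiv]
      simp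
      ring
    · simp only [(hf i _).fderiv]
      refine integrable_of_zero_outside_ball ?_ fun y hy => by simp [hΘ0 y hy]
      simp
      fun_prop
    · simp only [hΘf]
      exact integrable_of_zero_outside_ball (by fun_prop) fun y hy => by simp [hη0 y hy]
    · exact integrable_of_zero_outside_ball (by fun_prop) fun y hy => by simp [hΘ0 y hy]
    · exact fun y _ => (hf i y).differentiableAt
    · exact fun y _ => hΘd y
  have hexp : ∀ y, -(fderiv ℝ U (x - ε • y) y) * η y
      = -∑ i, fderiv ℝ U (x - ε • y) (e i) * fderiv ℝ Θ y (e i) := fun y => by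
    conv_lhs => rw [← e.sum_repr' y]
    simp only [map_sum, map_smul, hΘf, smul_eq_mul, neg_mul, Finset.sum_mul]
    congr 1
    refine Finset.sum_congr rfl fun i _ => ?_
    rw [real_inner_comm, e.sum_repr' y]
    ring
  simp only [hexp]
  rw [integral_neg, integral_finsetSum]
  · simp only [hparts]
    rw [← integral_finsetSum]
    · rw [neg_eq_zero]
      refine integral_eq_zero_of_ae (Filter.Eventually.of_forall fun y => ?_)
      simp only [Pi.zero_apply]
      rw [← Finset.mul_sum, ← Finset.sum_mul, ← laplacian_eq_sum_fderiv e]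
      by_cases hy : ‖y‖ < 1
      · simp [hΔ y hy]
      · simp [hΘ0 y (not_lt.1 hy)]
    · exact fun i _ => integrable_of_zero_outside_ball (by fun_prop) fun y hy => by simp [hΘ0 y hy]
  · intro i _
    simp only [hΘf]
    exact integrable_of_zero_outside_ball (by fun_prop) fun y hy => by simp [hη0 y hy]

/-- **Smoothness of harmonic functions.** -/
theorem contDiffAt_of_harmonicAt {u : E n → ℝ} {x₀ : E n}
    (hu : InnerProductSpace.HarmonicAt u x₀) : ContDiffAt ℝ (⊤ : ℕ∞) u x₀ := by
  obtain ⟨R, hR, hball⟩ := Metric.eventually_nhds_iff_ball.1 hu.eventually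
  obtain ⟨η, Θ, hη, hη0, hΘ0, hΘ, hpos⟩ := exists_radial_mollifier n
  let χ : ContDiffBump x₀ := ⟨R / 2, R * 3 / 4, by linarith, by linarith⟩
  let U : E n → ℝ := fun y => χ y * u y
  have hUs : tsupport χ ⊆ Metric.ball x₀ R := by
    rw [χ.tsupport_eq]
    exact Metric.closedBall_subset_ball (by simp [χ]; linarith)
  have hU : ContDiff ℝ 2 U := by
    rw [contDiff_iff_contDiffAt]
    intro y
    by_cases hy : y ∈ tsupport χ
    · exact (χ.contDiffAt).mul (hball y (hUs hy)).1
    · have h0 : U =ᶠ[𝓝 y] fun _ => 0 := by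
        filter_upwards [(isClosed_tsupport χ).isOpen_compl.mem_nhds hy] with z hz
        simp [U, image_eq_zero_of_notMem_tsupport hz]
      exact (contDiffAt_const).congr_of_eventuallyEq h0
  have hUc : HasCompactSupport U := χ.hasCompactSupport.mul_right
  have hUu : ∀ y ∈ Metric.ball x₀ (R / 2), U =ᶠ[𝓝 y] u := fun y hy => by
    filter_upwards [χ.eventuallyEq_one_of_mem_ball hy] with z hz
    simp [U, hz]
  have hUΔ : ∀ y ∈ Metric.ball x₀ (R / 2), Δ U y = 0 := fun y hy => by
    rw [(InnerProductSpace.laplacian_congr_nhds (hUu y hy)).eq_of_nhds]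
    exact (hball y (Metric.ball_subset_ball (by linarith) hy)).2.eq_of_nhds
  -- With this radius, x - ty stays in the ball of radius R/2, where U is harmonic, for all x within
  -- ρ of x₀, 0 ≤ t ≤ ρ and |y| < 1.
  let ρ : ℝ := R / 4
  have hρ : 0 < ρ := by simp only [ρ]; linarith
  have hconst : ∀ x ∈ Metric.ball x₀ ρ, ∫ y, U (x - ρ • y) * η y = U x * ∫ y, η y := by
    intro x hx
    have hd : ∀ t ∈ Set.Icc 0 ρ, HasDerivAt (fun t : ℝ => ∫ y, U (x - t • y) * η y) 0 t := by
      intro t ht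
      refine hasDerivAt_radial_average hη hη0 hΘ0 hΘ hU hUc x t fun y hy => hUΔ _ ?_
      rw [Metric.mem_ball] at hx ⊢
      have h1 : dist (x - t • y) x ≤ ρ * 1 := by
        rw [dist_eq_norm, sub_sub_cancel_left, norm_neg, norm_smul, Real.norm_of_nonneg ht.1]
        exact mul_le_mul ht.2 hy.le (norm_nonneg _) hρ.le
      have := dist_triangle (x - t • y) x x₀
      simp only [ρ] at *
      linarith
    have := constant_of_has_deriv_right_zero (f := fun t : ℝ => ∫ y, U (x - t • y) * η y)
      (fun t ht => (hd t ht).continuousAt.continuousWithinAt)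
      (fun t ht => (hd t (Set.Ico_subset_Icc_self ht)).hasDerivWithinAt) ρ ⟨hρ.le, le_rfl⟩
    rw [this]
    simp [integral_const_mul]
  let k : E n → ℝ := fun z => η (ρ⁻¹ • z)
  have hk : ContDiff ℝ (⊤ : ℕ∞) k := hη.comp (contDiff_const_smul _)
  have hkc : HasCompactSupport k :=
    HasCompactSupport.of_support_subset_isCompact (isCompact_closedBall (0 : E n) ρ) fun y hy => by
      by_contra hc
      refine hy (hη0 _ ?_)
      have hc : ρ < ‖y‖ := by simpa using hc
      rw [norm_smul, norm_inv, Real.norm_of_nonneg hρ.le, inv_mul_eq_div, one_le_div hρ]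
      exact hc.le
  have hsmooth : ContDiff ℝ (⊤ : ℕ∞) (convolution k U (ContinuousLinearMap.mul ℝ ℝ) volume) :=
    hkc.contDiff_convolution_left _ hk hU.continuous.locallyIntegrable
  set c : ℝ := |(ρ ^ Module.finrank ℝ (E n))⁻¹| with hc
  -- The substitution z = ρy turns the average at scale ρ into a convolution with a smooth kernel;
  -- `c` is the Jacobian.
  have hrep : u =ᶠ[𝓝 x₀] fun x =>
      c * convolution k U (ContinuousLinearMap.mul ℝ ℝ) volume x * (∫ y, η y)⁻¹ := by
    filter_upwards [Metric.ball_mem_nhds x₀ hρ] with x hx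
    have h1 := Measure.integral_comp_smul volume (fun z => k z * U (x - z)) ρ
    have h2 : ∀ y : E n, k (ρ • y) * U (x - ρ • y) = U (x - ρ • y) * η y := fun y => by
      simp only [k, smul_smul, inv_mul_cancel₀ hρ.ne', one_smul, mul_comm]
    simp only [h2] at h1
    rw [hconst x hx, smul_eq_mul, ← hc] at h1
    rw [convolution_def]
    simp only [ContinuousLinearMap.mul_apply']
    rw [← h1, mul_assoc, mul_inv_cancel₀ hpos.ne', mul_one]
    exact ((hUu x (Metric.ball_subset_ball (by simp only [ρ]; linarith) hx)).eq_of_nhds).symm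
  exact ((contDiff_const.mul hsmooth).mul contDiff_const).contDiffAt.congr_of_eventuallyEq hrep

/-! ### Symmetric convex functions of eigenvalues. -/

/-- Jensen's inequality for doubly stochastic matrices (via Birkhoff's theorem). -/
theorem map_mulVec_le_of_mem_doublyStochastic {f : (Fin n → ℝ) → ℝ}
    (hf : ConvexOn ℝ Set.univ f) (hs : IsSymmetricFun f) {M : Matrix (Fin n) (Fin n) ℝ}
    (hM : M ∈ doublyStochastic ℝ (Fin n)) (l : Fin n → ℝ) : f (M.mulVec l) ≤ f l := by
  obtain ⟨w, hw0, hw1, rfl⟩ := exists_eq_sum_perm_of_mem_doublyStochastic hM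
  have h1 : (∑ σ, w σ • Equiv.Perm.permMatrix ℝ σ).mulVec l = ∑ σ, w σ • (l ∘ σ) := by
    rw [Matrix.sum_mulVec]
    refine Finset.sum_congr rfl fun σ _ => ?_
    rw [Matrix.smul_mulVec, Matrix.permMatrix_mulVec]
  rw [h1]
  refine (hf.map_sum_le (fun σ _ => hw0 σ) hw1 fun _ _ => Set.mem_univ _).trans ?_
  simp only [hs _ l, smul_eq_mul]
  rw [← Finset.sum_mul, hw1, one_mul]

theorem sum_inner_sq_mul_of_eigenbasis {H : E n →L[ℝ] E n →L[ℝ] ℝ}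
    {e : OrthonormalBasis (Fin n) ℝ (E n)} {μ : Fin n → ℝ}
    (he : ∀ i w, H (e i) w = μ i * inner ℝ (e i) w) (v : E n) :
    H v v = ∑ j, inner ℝ (e j) v ^ 2 * μ j := by
  conv_lhs => enter [1]; rw [← e.sum_repr' v]
  simp only [map_sum, map_smul, _root_.sum_apply, _root_.smul_apply, he,
    smul_eq_mul]
  exact Finset.sum_congr rfl fun i _ => by ring

/-- **Schur–Horn inequality**: the diagonal of a symmetric form in an orthonormal basis is
dominated by its eigenvalues. -/
theorem map_diag_le_map_eigenvalues {f : (Fin n → ℝ) → ℝ}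
    (hf : ConvexOn ℝ Set.univ f) (hs : IsSymmetricFun f) {H : E n →L[ℝ] E n →L[ℝ] ℝ}
    {e : OrthonormalBasis (Fin n) ℝ (E n)} {μ : Fin n → ℝ}
    (he : ∀ i w, H (e i) w = μ i * inner ℝ (e i) w) (q : OrthonormalBasis (Fin n) ℝ (E n)) :
    f (fun i => H (q i) (q i)) ≤ f μ := by
  let M : Matrix (Fin n) (Fin n) ℝ := Matrix.of fun i j => inner ℝ (e j) (q i) ^ 2
  have hM : M ∈ doublyStochastic ℝ (Fin n) := by
    rw [mem_doublyStochastic_iff_sum]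
    refine ⟨fun i j => by simp [M, sq_nonneg], fun i => ?_, fun j => ?_⟩
    · simpa [M] using e.sum_sq_norm_inner_right (q i)
    · simpa [M] using q.sum_sq_norm_inner_left (e j)
  have h1 : (fun i => H (q i) (q i)) = M.mulVec μ := by
    ext i
    rw [sum_inner_sq_mul_of_eigenbasis he]
    rfl
  rw [h1]
  exact map_mulVec_le_of_mem_doublyStochastic hf hs hM μ

/-- Schur–Horn applied in both directions makes the value independent of the diagonalisation, so
eigenvalue lists need not be matched by a permutation. -/
theorem map_eigenvalues_eq {f : (Fin n → ℝ) → ℝ}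
    (hf : ConvexOn ℝ Set.univ f) (hs : IsSymmetricFun f) {H : E n →L[ℝ] E n →L[ℝ] ℝ}
    {e e' : OrthonormalBasis (Fin n) ℝ (E n)} {μ μ' : Fin n → ℝ}
    (he : ∀ i w, H (e i) w = μ i * inner ℝ (e i) w)
    (he' : ∀ i w, H (e' i) w = μ' i * inner ℝ (e' i) w) : f μ = f μ' := by
  have h : ∀ {e : OrthonormalBasis (Fin n) ℝ (E n)} {μ : Fin n → ℝ}
      (_ : ∀ i w, H (e i) w = μ i * inner ℝ (e i) w), (fun i => H (e i) (e i)) = μ := by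
    intro e μ he
    ext i
    simp [he]
  refine le_antisymm ?_ ?_
  · simpa only [h he] using map_diag_le_map_eigenvalues hf hs he' e
  · simpa only [h he'] using map_diag_le_map_eigenvalues hf hs he e'

theorem fderiv_fderiv_apply_eq_sum_hessian (u : E n → ℝ) (x v w : E n) :
    fderiv ℝ (fderiv ℝ u) x v w = ∑ i, ∑ j, v i * w j * hessian u x i j := by
  let b := EuclideanSpace.basisFun (Fin n) ℝ
  have hv : ∀ v : E n, v = ∑ i, v i • b i := fun v => by
    conv_lhs => rw [← b.sum_repr v]
    rfl
  conv_lhs => rw [hv v, hv w]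
  simp only [map_sum, map_smul, _root_.sum_apply, _root_.smul_apply, smul_eq_mul]
  simp only [Finset.mul_sum]
  rw [Finset.sum_comm]
  refine Finset.sum_congr rfl fun i _ => Finset.sum_congr rfl fun j _ => ?_
  rw [hessian, Matrix.of_apply, iteratedFDeriv_two_apply]
  change _ = v i * w j * fderiv ℝ (fderiv ℝ u) x (b i) (b j)
  ring

theorem exists_eigenbasis_hessian {u : E n → ℝ} {x : E n} (hu : ContDiffAt ℝ 2 u x) :
    ∃ e : OrthonormalBasis (Fin n) ℝ (E n), ∀ i w,
      fderiv ℝ (fderiv ℝ u) x (e i) w = eigenvalues (hessian u x) i * inner ℝ (e i) w := by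
  classical
  have hA := hessian_isHermitian hu
  refine ⟨hA.eigenvectorBasis, fun i w => ?_⟩
  have hl : eigenvalues (hessian u x) = hA.eigenvalues := by
    rw [eigenvalues, dif_pos hA]
  have h1 : ∀ j, ∑ a, hA.eigenvectorBasis i a * hessian u x a j
      = hA.eigenvalues i * hA.eigenvectorBasis i j := fun j => by
    have := congrFun (hA.mulVec_eigenvectorBasis i) j
    simp only [Matrix.mulVec, dotProduct, Pi.smul_apply, smul_eq_mul] at this
    rw [← this]
    refine Finset.sum_congr rfl fun a _ => ?_
    rw [← hA.apply a j]
    simp [mul_comm]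
  rw [fderiv_fderiv_apply_eq_sum_hessian, Finset.sum_comm, hl, PiLp.inner_apply, Finset.mul_sum]
  refine Finset.sum_congr rfl fun j _ => ?_
  have : ∀ a, hA.eigenvectorBasis i a * w j * hessian u x a j
      = w j * (hA.eigenvectorBasis i a * hessian u x a j) := fun a => by ring
  simp only [this]
  rw [← Finset.mul_sum, h1 j]
  simp
  ring

/-! ### Subgradients of `f`. -/

/-- A subgradient at `l` which takes equal values at indices where `l` does. -/
theorem exists_subgradient {f : (Fin n → ℝ) → ℝ} (hf : ConvexOn ℝ Set.univ f)
    (hs : IsSymmetricFun f) (hh : IsHomogeneousOneOn f Set.univ) (l : Fin n → ℝ) :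
    ∃ p : Fin n → ℝ, (∀ m, ∑ i, p i * m i ≤ f m) ∧ ∑ i, p i * l i = f l ∧
      ∀ i j, l i = l j → p i = p j := by
  have hhom : ∀ c : ℝ, 0 < c → ∀ x, f (c • x) = c * f x :=
    fun c hc x => hh x trivial c hc trivial
  have h0 : f 0 = 0 := by
    have := hhom 2 (by norm_num) 0
    rw [smul_zero] at this
    linarith
  have hadd : ∀ x y, f (x + y) ≤ f x + f y := fun x y => by
    have h1 := hf.2 (Set.mem_univ x) (Set.mem_univ y) (show (0 : ℝ) ≤ 1 / 2 by norm_num)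
      (show (0 : ℝ) ≤ 1 / 2 by norm_num) (by norm_num)
    rw [← smul_add, hhom _ (by norm_num), smul_eq_mul, smul_eq_mul] at h1
    linarith
  -- Hahn–Banach: `f` is sublinear, so the functional sending l to f(l) on the line through l
  -- extends below `f`.
  have hlin : ∃ g : (Fin n → ℝ) →ₗ[ℝ] ℝ, g l = f l ∧ ∀ m, g m ≤ f m := by
    by_cases hl : l = 0
    · obtain ⟨g, -, hg⟩ := exists_extension_of_le_sublinear ⟨⊥, 0⟩ f hhom hadd
        (fun x => by
          have hx : x = 0 := Subsingleton.elim x 0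
          rw [hx]
          simp [h0])
      exact ⟨g, by rw [hl, map_zero, h0], hg⟩
    · obtain ⟨g, hg1, hg⟩ := exists_extension_of_le_sublinear
        (LinearPMap.mkSpanSingleton (σ := RingHom.id ℝ) l (f l) hl) f hhom hadd
        (fun x => by
          obtain ⟨x, hx⟩ := x
          obtain ⟨c, rfl⟩ := Submodule.mem_span_singleton.1 hx
          rw [LinearPMap.mkSpanSingleton'_apply]
          simp only [RingHom.id_apply, smul_eq_mul]
          rcases lt_trichotomy c 0 with hc | rfl | hc
          · have h1 := hadd (c • l) ((-c) • l)
            rw [← add_smul, add_neg_cancel, zero_smul, h0, hhom (-c) (by linarith)] at h1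
            linarith
          · simp [h0]
          · rw [hhom c hc])
      refine ⟨g, ?_, hg⟩
      have h1 := hg1 ⟨l, Submodule.mem_span_singleton_self l⟩
      rw [h1]
      exact LinearPMap.mkSpanSingleton'_apply_self _ _ _ _
  obtain ⟨g, hgl, hg⟩ := hlin
  have hgsum : ∀ m, g m = ∑ i, g (Pi.single i 1) * m i := fun m => by
    conv_lhs => rw [← Finset.univ_sum_single m]
    rw [map_sum]
    refine Finset.sum_congr rfl fun i _ => ?_
    rw [show Pi.single i (m i) = m i • (Pi.single i (1 : ℝ) : Fin n → ℝ) by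
      rw [← Pi.single_smul]; simp, map_smul, smul_eq_mul, mul_comm]
  classical
  -- Averaging over the stabiliser of `l` keeps both subgradient properties, as `f` is symmetric,
  -- and equalises `p i` and `p j` when `l i = l j`, since the transposition of i and j then lies in
  -- the stabiliser.
  let S : Finset (Equiv.Perm (Fin n)) := Finset.univ.filter fun σ => l ∘ σ = l
  have hS : 0 < (S.card : ℝ) := by
    have : S.Nonempty := ⟨1, by simp [S]⟩
    exact_mod_cast this.card_pos
  let p : Fin n → ℝ := fun i => (∑ σ ∈ S, g (Pi.single (σ i) 1)) / S.card
  have hp : ∀ m, ∑ i, p i * m i = (∑ σ ∈ S, g (m ∘ (σ⁻¹ : Equiv.Perm (Fin n)))) / S.card := by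
    intro m
    simp only [p, div_mul_eq_mul_div]
    rw [← Finset.sum_div]
    congr 1
    simp only [Finset.sum_mul]
    rw [Finset.sum_comm]
    refine Finset.sum_congr rfl fun σ _ => ?_
    rw [hgsum, ← Equiv.sum_comp σ (fun i => g (Pi.single i 1) * _)]
    simp
  refine ⟨p, fun m => ?_, ?_, fun i j hij => ?_⟩
  · rw [hp, div_le_iff₀ hS]
    calc ∑ σ ∈ S, g (m ∘ (σ⁻¹ : Equiv.Perm (Fin n))) ≤ ∑ σ ∈ S, f m :=
          Finset.sum_le_sum fun σ _ => (hg _).trans (hs _ m).le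
      _ = f m * S.card := by simp [mul_comm]
  · rw [hp, div_eq_iff hS.ne']
    calc ∑ σ ∈ S, g (l ∘ (σ⁻¹ : Equiv.Perm (Fin n))) = ∑ σ ∈ S, f l := by
          refine Finset.sum_congr rfl fun σ hσ => ?_
          have h1 : l ∘ σ = l := (Finset.mem_filter.1 hσ).2
          rw [← hgl]
          congr 1
          conv_lhs => rw [← h1]
          ext i
          simp
      _ = f l * S.card := by simp [mul_comm]
  · simp only [p]
    congr 1
    have hsw : l ∘ Equiv.swap i j = l := by
      ext a
      simp only [Function.comp_apply, Equiv.swap_apply_def]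
      split_ifs with h1 h2
      · rw [h1, hij]
      · rw [h2, hij]
      · rfl
    refine Finset.sum_nbij' (fun σ => σ * Equiv.swap i j) (fun σ => σ * Equiv.swap i j)
      ?_ ?_ ?_ ?_ ?_
    · intro σ hσ
      have h1 : l ∘ σ = l := (Finset.mem_filter.1 hσ).2
      simp only [S, Finset.mem_filter, Finset.mem_univ, true_and, Equiv.Perm.coe_mul]
      rw [← Function.comp_assoc, h1, hsw]
    · intro σ hσ
      have h1 : l ∘ σ = l := (Finset.mem_filter.1 hσ).2
      simp only [S, Finset.mem_filter, Finset.mem_univ, true_and, Equiv.Perm.coe_mul]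
      rw [← Function.comp_assoc, h1, hsw]
    · intro σ _
      simp [mul_assoc]
    · intro σ _
      simp [mul_assoc]
    · intro σ _
      simp

/-- Test the subgradient on `l` with entries i and j exchanged: `f` is unchanged, and what remains
of the inequality is the claim. -/
theorem subgradient_monotone {f : (Fin n → ℝ) → ℝ} (hs : IsSymmetricFun f) {l p : Fin n → ℝ}
    (hp : ∀ m, ∑ i, p i * m i ≤ f m) (hl : ∑ i, p i * l i = f l) (i j : Fin n) :
    0 ≤ (p i - p j) * (l i - l j) := by
  by_cases hij : i = j
  · simp [hij]
  have h1 := hp (l ∘ Equiv.swap i j)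
  rw [hs, ← hl] at h1
  have h2 : ∀ m : Fin n → ℝ, ∑ a, p a * m a
      = p i * m i + (p j * m j + ∑ a ∈ (Finset.univ.erase i).erase j, p a * m a) := fun m => by
    rw [← Finset.add_sum_erase _ _ (Finset.mem_univ i),
      ← Finset.add_sum_erase (Finset.univ.erase i) _
        (Finset.mem_erase.2 ⟨fun h => hij h.symm, Finset.mem_univ j⟩)]
  rw [h2, h2] at h1
  have h3 : ∑ a ∈ (Finset.univ.erase i).erase j, p a * (l ∘ Equiv.swap i j) a
      = ∑ a ∈ (Finset.univ.erase i).erase j, p a * l a :=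
    Finset.sum_congr rfl fun a ha => by
      simp only [Finset.mem_erase] at ha
      rw [Function.comp_apply, Equiv.swap_apply_of_ne_of_ne ha.2.1 ha.1]
  rw [h3] at h1
  simp only [Function.comp_apply, Equiv.swap_apply_left, Equiv.swap_apply_right] at h1
  nlinarith

/-! ### Supporting functions and continuity of `w`. -/

/-- Supporting linear functions of `w` in terms of orthonormal frames. -/
theorem sum_mul_diag_le_hessianFunction {f : (Fin n → ℝ) → ℝ} (hf : ConvexOn ℝ Set.univ f)
    (hs : IsSymmetricFun f) {p : Fin n → ℝ} (hp : ∀ m, ∑ i, p i * m i ≤ f m) {u : E n → ℝ}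
    {x : E n} (hu : ContDiffAt ℝ 2 u x) (q : OrthonormalBasis (Fin n) ℝ (E n)) :
    ∑ i, p i * fderiv ℝ (fderiv ℝ u) x (q i) (q i) ≤ hessianFunction f u x := by
  obtain ⟨e, he⟩ := exists_eigenbasis_hessian hu
  exact (hp _).trans (map_diag_le_map_eigenvalues hf hs he q)

theorem hessianFunction_eq {f : (Fin n → ℝ) → ℝ} (hf : ConvexOn ℝ Set.univ f)
    (hs : IsSymmetricFun f) {u : E n → ℝ} {x : E n} (hu : ContDiffAt ℝ 2 u x)
    {e : OrthonormalBasis (Fin n) ℝ (E n)} {μ : Fin n → ℝ}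
    (he : ∀ i w, fderiv ℝ (fderiv ℝ u) x (e i) w = μ i * inner ℝ (e i) w) :
    hessianFunction f u x = f μ := by
  obtain ⟨e', he'⟩ := exists_eigenbasis_hessian hu
  exact map_eigenvalues_eq hf hs he' he

/-- Subgradients of a convex function homogeneous of degree one are uniformly bounded. -/
theorem exists_subgradient_bound (f : (Fin n → ℝ) → ℝ) :
    ∃ C : ℝ, ∀ p : Fin n → ℝ, (∀ m, ∑ i, p i * m i ≤ f m) → ∀ i, |p i| ≤ C := by
  refine ⟨∑ i, (|f (Pi.single i 1)| + |f (Pi.single i (-1))|),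
    fun p hp i => ?_⟩
  have h1 := hp (Pi.single i 1)
  have h2 := hp (Pi.single i (-1))
  simp only [Pi.single_apply, mul_ite, mul_zero, Finset.sum_ite_eq',
    Finset.mem_univ, if_true] at h1 h2
  refine le_trans ?_ (Finset.single_le_sum
    (f := fun i => |f (Pi.single i 1)| + |f (Pi.single i (-1))|)
    (fun i _ => by positivity) (Finset.mem_univ i))
  have h3 := le_abs_self (f (Pi.single i 1))
  have h4 := le_abs_self (f (Pi.single i (-1)))
  have h5 := abs_nonneg (f (Pi.single i 1))
  have h6 := abs_nonneg (f (Pi.single i (-1)))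
  rw [abs_le]
  constructor <;> linarith

/-- A subgradient at `x` with the eigenframe of `x` gives equality at `x` and a lower bound at `y`,
so the difference is at most a bounded linear expression in the difference of the Hessians. -/
theorem hessianFunction_sub_le {f : (Fin n → ℝ) → ℝ} (hf : ConvexOn ℝ Set.univ f)
    (hs : IsSymmetricFun f) (hh : IsHomogeneousOneOn f Set.univ) {C : ℝ}
    (hC : ∀ p : Fin n → ℝ, (∀ m, ∑ i, p i * m i ≤ f m) → ∀ i, |p i| ≤ C) {u : E n → ℝ}
    {x y : E n} (hx : ContDiffAt ℝ 2 u x) (hy : ContDiffAt ℝ 2 u y) :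
    hessianFunction f u x - hessianFunction f u y
      ≤ n * C * ‖fderiv ℝ (fderiv ℝ u) x - fderiv ℝ (fderiv ℝ u) y‖ := by
  obtain ⟨e, he⟩ := exists_eigenbasis_hessian hx
  obtain ⟨p, hp, hpl, -⟩ := exists_subgradient hf hs hh (eigenvalues (hessian u x))
  have h1 := sum_mul_diag_le_hessianFunction hf hs hp hy e
  have h2 : hessianFunction f u x = ∑ i, p i * fderiv ℝ (fderiv ℝ u) x (e i) (e i) := by
    rw [hessianFunction, ← hpl]
    simp [he]
  have h3 : ∀ i, p i * fderiv ℝ (fderiv ℝ u) x (e i) (e i)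
      - p i * fderiv ℝ (fderiv ℝ u) y (e i) (e i)
      ≤ C * ‖fderiv ℝ (fderiv ℝ u) x - fderiv ℝ (fderiv ℝ u) y‖ := fun i => by
    have h4 := (fderiv ℝ (fderiv ℝ u) x - fderiv ℝ (fderiv ℝ u) y).le_opNorm₂ (e i) (e i)
    simp only [e.norm_eq_one, mul_one] at h4
    calc _ = p i * (fderiv ℝ (fderiv ℝ u) x - fderiv ℝ (fderiv ℝ u) y) (e i) (e i) := by
          simp [mul_sub]
      _ ≤ |p i| * ‖(fderiv ℝ (fderiv ℝ u) x - fderiv ℝ (fderiv ℝ u) y) (e i) (e i)‖ := by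
          rw [Real.norm_eq_abs, ← abs_mul]
          exact le_abs_self _
      _ ≤ _ := mul_le_mul (hC p hp i) h4 (norm_nonneg _) ((abs_nonneg _).trans (hC p hp i))
  calc _ ≤ ∑ i, (p i * fderiv ℝ (fderiv ℝ u) x (e i) (e i)
        - p i * fderiv ℝ (fderiv ℝ u) y (e i) (e i)) := by
        rw [Finset.sum_sub_distrib, ← h2]
        linarith
    _ ≤ ∑ _i : Fin n, C * ‖fderiv ℝ (fderiv ℝ u) x - fderiv ℝ (fderiv ℝ u) y‖ :=
        Finset.sum_le_sum fun i _ => h3 i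
    _ = _ := by simp [mul_assoc]

theorem continuousAt_hessianFunction {f : (Fin n → ℝ) → ℝ} (hf : ConvexOn ℝ Set.univ f)
    (hs : IsSymmetricFun f) (hh : IsHomogeneousOneOn f Set.univ) {u : E n → ℝ}
    {x : E n} (hx : ContDiffAt ℝ 2 u x) : ContinuousAt (hessianFunction f u) x := by
  obtain ⟨C, hC⟩ := exists_subgradient_bound f
  have hc : ContinuousAt (fderiv ℝ (fderiv ℝ u)) x :=
    ((hx.fderiv_right (m := 1) (by norm_num)).fderiv_right (m := 0) (by norm_num)).continuousAt
  have hlim : Filter.Tendsto (fun y => n * C * ‖fderiv ℝ (fderiv ℝ u) y - fderiv ℝ (fderiv ℝ u) x‖)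
      (𝓝 x) (𝓝 0) := by
    have := ((tendsto_iff_norm_sub_tendsto_zero (E := E n →L[ℝ] E n →L[ℝ] ℝ)).1
      hc.tendsto).const_mul (n * C)
    rwa [mul_zero] at this
  rw [ContinuousAt, tendsto_iff_dist_tendsto_zero]
  refine squeeze_zero' (Filter.Eventually.of_forall fun _ => dist_nonneg) ?_ hlim
  filter_upwards [hx.eventually (by simp)] with y hy
  rw [Real.dist_eq, abs_le]
  have h1 := hessianFunction_sub_le hf hs hh hC hx hy
  have h2 := hessianFunction_sub_le hf hs hh hC hy hx
  rw [norm_sub_rev (fderiv ℝ (fderiv ℝ u) x)] at h1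
  constructor <;> linarith

/-! ### Second-order calculus along curves. -/

section SecondDeriv

variable {F G : Type*} [NormedAddCommGroup F] [NormedSpace ℝ F] [NormedAddCommGroup G]
  [NormedSpace ℝ G]

/-- `g` is twice differentiable at `0`, with first derivative `a` and second derivative `b`. -/
def HasSecondDerivAtZero (g : ℝ → F) (a b : F) : Prop :=
  ∃ g' : ℝ → F, (∀ᶠ t in 𝓝 0, HasDerivAt g (g' t) t) ∧ g' 0 = a ∧ HasDerivAt g' b 0

theorem HasSecondDerivAtZero.congr_values {g : ℝ → F} {a b a' b' : F}
    (h : HasSecondDerivAtZero g a b) (ha : a = a') (hb : b = b') :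
    HasSecondDerivAtZero g a' b' := ha ▸ hb ▸ h

theorem HasSecondDerivAtZero.sub {g h : ℝ → F} {a b c d : F} (hg : HasSecondDerivAtZero g a b)
    (hh : HasSecondDerivAtZero h c d) :
    HasSecondDerivAtZero (fun t => g t - h t) (a - c) (b - d) := by
  obtain ⟨g', h1, rfl, h2⟩ := hg
  obtain ⟨h', h3, rfl, h4⟩ := hh
  refine ⟨fun t => g' t - h' t, ?_, rfl, h2.sub h4⟩
  filter_upwards [h1, h3] with t ht ht' using ht.sub ht'

theorem HasSecondDerivAtZero.const_mul_sum {ι : Type*} (s : Finset ι) (p : ι → ℝ)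
    {g : ι → ℝ → ℝ} {a b : ι → ℝ} (hg : ∀ i ∈ s, HasSecondDerivAtZero (g i) (a i) (b i)) :
    HasSecondDerivAtZero (fun t => ∑ i ∈ s, p i * g i t) (∑ i ∈ s, p i * a i)
      (∑ i ∈ s, p i * b i) := by
  choose! g' h1 h2 h3 using hg
  refine ⟨fun t => ∑ i ∈ s, p i * g' i t, ?_, ?_, ?_⟩
  · have := (Finset.eventually_all s).2 h1
    filter_upwards [this] with t ht
    exact HasDerivAt.fun_sum fun i hi => (ht i hi).const_mul _
  · exact Finset.sum_congr rfl fun i hi => by rw [h2 i hi]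
  · exact HasDerivAt.fun_sum fun i hi => (h3 i hi).const_mul _

theorem HasSecondDerivAtZero.clm_apply {c : ℝ → F →L[ℝ] G} {v : ℝ → F} {c₁ c₂ : F →L[ℝ] G}
    {v₁ v₂ : F} (hc : HasSecondDerivAtZero c c₁ c₂) (hv : HasSecondDerivAtZero v v₁ v₂) :
    HasSecondDerivAtZero (fun t => c t (v t)) (c₁ (v 0) + c 0 v₁)
      (c₂ (v 0) + 2 • c₁ v₁ + c 0 v₂) := by
  obtain ⟨c', h1, rfl, h2⟩ := hc
  obtain ⟨v', h3, rfl, h4⟩ := hv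
  refine ⟨fun t => c' t (v t) + c t (v' t), ?_, rfl, ?_⟩
  · filter_upwards [h1, h3] with t ht ht' using ht.clm_apply ht'
  · convert! (h2.clm_apply h3.self_of_nhds).add (h1.self_of_nhds.clm_apply h4) using 1
    rw [two_smul]
    abel

/-- Were the second derivative negative, 0 would also be a local maximum, so `g` would be locally
constant and its second derivative zero. -/
theorem HasSecondDerivAtZero.of_isLocalMin {g : ℝ → ℝ} {a b : ℝ}
    (hg : HasSecondDerivAtZero g a b) (hmin : IsLocalMin g 0) : a = 0 ∧ 0 ≤ b := by
  obtain ⟨g', h1, rfl, h2⟩ := hg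
  have h3 : g' 0 = 0 := hmin.hasDerivAt_eq_zero h1.self_of_nhds
  refine ⟨h3, ?_⟩
  by_contra! hb
  have h4 : deriv g =ᶠ[𝓝 0] g' := h1.mono fun t ht => ht.deriv
  have h5 : deriv (deriv g) 0 = b := by rw [h4.deriv_eq, h2.deriv]
  have hmax : IsLocalMax g 0 := isLocalMax_of_deriv_deriv_neg (h5 ▸ hb)
    (h4.self_of_nhds.trans h3) h1.self_of_nhds.continuousAt
  have h6 : g =ᶠ[𝓝 0] fun _ => g 0 := by
    filter_upwards [hmin, hmax] with t ht ht' using le_antisymm ht' ht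
  have h7 : deriv g =ᶠ[𝓝 0] fun _ => 0 := by
    filter_upwards [h6.eventuallyEq_nhds] with t ht
    rw [ht.deriv_eq, deriv_const]
  rw [h7.deriv_eq, deriv_const] at h5
  exact hb.ne h5.symm

theorem HasSecondDerivAtZero.of_touching {φ ψ : ℝ → ℝ} {a b c d : ℝ}
    (hφ : HasSecondDerivAtZero φ a b) (hψ : HasSecondDerivAtZero ψ c d)
    (h0 : φ 0 = ψ 0) (hle : ∀ᶠ t in 𝓝 0, ψ t ≤ φ t) : a = c ∧ d ≤ b := by
  have h := (hφ.sub hψ).of_isLocalMin (by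
    filter_upwards [hle] with t ht
    simp only [h0, sub_self]
    linarith)
  exact ⟨by linarith [h.1], by linarith [h.2]⟩

end SecondDeriv

theorem hasSecondDerivAtZero_line {F : Type*} [NormedAddCommGroup F] [NormedSpace ℝ F]
    {g : E n → F} {x : E n} (hg : ContDiffAt ℝ 2 g x) (v : E n) :
    HasSecondDerivAtZero (fun t : ℝ => g (x + t • v)) (fderiv ℝ g x v)
      (fderiv ℝ (fderiv ℝ g) x v v) := by
  have hl : ∀ t : ℝ, HasDerivAt (fun t : ℝ => x + t • v) v t := fun t => by
    simpa using ((hasDerivAt_id t).smul_const v).const_add x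
  have hc : Filter.Tendsto (fun t : ℝ => x + t • v) (𝓝 0) (𝓝 x) := by
    have := (hl 0).continuousAt.tendsto
    simpa using this
  refine ⟨fun t => fderiv ℝ g (x + t • v) v, ?_, by simp, ?_⟩
  · filter_upwards [hc.eventually (hg.eventually (by simp))] with t ht
    exact (ht.differentiableAt (by norm_num)).hasFDerivAt.comp_hasDerivAt t (hl t)
  · have h1 : HasFDerivAt (fderiv ℝ g) (fderiv ℝ (fderiv ℝ g) x) (x + (0 : ℝ) • v) := by
      simpa using ((hg.fderiv_right (m := 1) (by norm_num)).differentiableAt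
        (by norm_num)).hasFDerivAt
    have h2 := h1.comp_hasDerivAt (0 : ℝ) (hl 0)
    have h3 := h2.clm_apply (hasDerivAt_const (0 : ℝ) v)
    simpa using h3

/-! ### Rotating frames and third derivatives. -/

theorem hasSecondDerivAtZero_exp (B : E n →L[ℝ] E n) (v : E n) :
    HasSecondDerivAtZero (fun t : ℝ => NormedSpace.exp (t • B) v) (B v) (B (B v)) := by
  have h : ∀ t : ℝ, ∀ w, HasDerivAt (fun t : ℝ => NormedSpace.exp (t • B) w)
      (NormedSpace.exp (t • B) (B w)) t := fun t w => by
    simpa using (hasDerivAt_exp_smul_const B t).clm_apply (hasDerivAt_const t w)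
  have hz : NormedSpace.exp ((0 : ℝ) • B) = 1 := by
    rw [show (0 : ℝ) • B = 0 from zero_smul ℝ B, NormedSpace.exp_zero]
  refine ⟨fun t => NormedSpace.exp (t • B) (B v), Filter.Eventually.of_forall fun t => h t v,
    by simp only [hz, one_apply_eq_self], ?_⟩
  simpa only [hz, one_apply_eq_self] using h 0 (B v)

/-- The skew-adjoint operator with a given antisymmetric matrix in an orthonormal basis. -/
theorem exists_skewAdjoint (e : OrthonormalBasis (Fin n) ℝ (E n)) {b : Fin n → Fin n → ℝ}
    (hb : ∀ i j, b i j = -b j i) :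
    ∃ B : E n →L[ℝ] E n, B ∈ skewAdjoint (E n →L[ℝ] E n) ∧ ∀ i, B (e i) = ∑ j, b j i • e j := by
  let B : E n →L[ℝ] E n := ∑ i, ∑ j, b j i • (innerSL ℝ (e i)).smulRight (e j)
  have hB : ∀ v, B v = ∑ i, ∑ j, b j i • inner ℝ (e i) v • e j := fun v => by
    simp [B]
  refine ⟨B, ?_, fun i => ?_⟩
  · rw [skewAdjoint.mem_iff, ContinuousLinearMap.star_eq_adjoint, eq_comm,
      ContinuousLinearMap.eq_adjoint_iff]
    intro v w
    simp only [_root_.neg_apply, hB, inner_neg_left, sum_inner, inner_sum,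
      inner_smul_left, inner_smul_right]
    rw [Finset.sum_comm, ← Finset.sum_neg_distrib]
    refine Finset.sum_congr rfl fun i _ => ?_
    rw [← Finset.sum_neg_distrib]
    refine Finset.sum_congr rfl fun j _ => ?_
    rw [hb i j, real_inner_comm v (e j)]
    simp only [conj_trivial]
    ring
  · rw [hB, Finset.sum_eq_single i]
    · simp
    · intro j _ hj
      simp [e.inner_eq_zero hj]
    · simp

theorem exists_rotated_basis (e : OrthonormalBasis (Fin n) ℝ (E n)) {B : E n →L[ℝ] E n}
    (hB : B ∈ skewAdjoint (E n →L[ℝ] E n)) (t : ℝ) :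
    ∃ q : OrthonormalBasis (Fin n) ℝ (E n), ∀ i, q i = NormedSpace.exp (t • B) (e i) := by
  let _ : NormedAlgebra ℚ (E n →L[ℝ] E n) := NormedAlgebra.restrictScalars ℚ ℝ _
  have h1 : t • B ∈ skewAdjoint (E n →L[ℝ] E n) := skewAdjoint.smul_mem t hB
  have h2 := NormedSpace.exp_mem_unitary_of_mem_skewAdjoint h1
  exact ⟨e.map (Unitary.linearIsometryEquiv ⟨_, h2⟩), fun i => by
    rw [OrthonormalBasis.map_apply]
    rfl⟩

theorem two_le_smooth : (2 : WithTop ℕ∞) ≤ ((⊤ : ℕ∞) : WithTop ℕ∞) := by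
  exact WithTop.coe_le_coe.2 le_top

/-- The second derivative of `u` as a bilinear form. -/
abbrev hessianForm (u : E n → ℝ) (x : E n) : E n →L[ℝ] E n →L[ℝ] ℝ := fderiv ℝ (fderiv ℝ u) x

theorem contDiffAt_hessianForm {u : E n → ℝ} {x : E n} (hu : ContDiffAt ℝ (⊤ : ℕ∞) u x) :
    ContDiffAt ℝ (⊤ : ℕ∞) (hessianForm u) x :=
  (hu.fderiv_right (m := (⊤ : ℕ∞)) (by simp)).fderiv_right (m := (⊤ : ℕ∞)) (by simp)

theorem thirdDeriv_symm_right {u : E n → ℝ} {x : E n} (hu : ContDiffAt ℝ (⊤ : ℕ∞) u x)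
    (v a b : E n) : fderiv ℝ (hessianForm u) x v a b = fderiv ℝ (hessianForm u) x v b a := by
  have h1 : ∀ᶠ y in 𝓝 x, hessianForm u y a b = hessianForm u y b a := by
    filter_upwards [(hu.of_le two_le_smooth).eventually (by simp)] with y hy
    exact (hy.isSymmSndFDerivAt (by simp)) a b
  have hd := (contDiffAt_hessianForm hu).differentiableAt (by simp)
  have h2 : ∀ a b : E n, HasFDerivAt (fun y => hessianForm u y a b)
      (((fderiv ℝ (hessianForm u) x).flip a).flip b) x := fun a b => by
    convert! (hd.hasFDerivAt.clm_apply (hasFDerivAt_const a x)).clm_apply (hasFDerivAt_const b x)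
      using 1
    ext v
    simp
  have h3 := (h2 a b).unique ((h2 b a).congr_of_eventuallyEq h1)
  simpa using DFunLike.congr_fun h3 v

theorem thirdDeriv_symm_left {u : E n → ℝ} {x : E n} (hu : ContDiffAt ℝ (⊤ : ℕ∞) u x)
    (v a b : E n) : fderiv ℝ (hessianForm u) x v a b = fderiv ℝ (hessianForm u) x a v b := by
  have h1 : ContDiffAt ℝ 2 (fderiv ℝ u) x := 
    (hu.fderiv_right (m := (⊤ : ℕ∞)) (by simp)).of_le two_le_smooth
  exact DFunLike.congr_fun ((h1.isSymmSndFDerivAt (by simp)) v a) b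

-- The minorant is Σ pᵢ D²u(x+tv) evaluated on the frame exp(tB)eᵢ. To first order the rotation
-- contributes only multiples of bᵢᵢ = 0. To second order it adds 4 D³u(v,Beᵢ,eᵢ) + 2 D²u(Beᵢ,Beᵢ) +
-- 2 D²u(eᵢ,B²eᵢ), which is the sum over j.
set_option maxSynthPendingDepth 3 in
theorem touching_along_line {f : (Fin n → ℝ) → ℝ} (hf : ConvexOn ℝ Set.univ f)
    (hs : IsSymmetricFun f) {u : E n → ℝ} {x : E n} (hu : ContDiffAt ℝ (⊤ : ℕ∞) u x)
    {e : OrthonormalBasis (Fin n) ℝ (E n)} {μ : Fin n → ℝ}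
    (he : ∀ i w, hessianForm u x (e i) w = μ i * inner ℝ (e i) w)
    {p : Fin n → ℝ} (hp : ∀ m, ∑ i, p i * m i ≤ f m) (hpμ : ∑ i, p i * μ i = f μ)
    {φ : E n → ℝ} (hφ : ContDiffAt ℝ 2 φ x) (hφx : φ x = hessianFunction f u x)
    (hle : ∀ᶠ y in 𝓝 x, hessianFunction f u y ≤ φ y) (v : E n) {b : Fin n → Fin n → ℝ}
    (hb : ∀ i j, b i j = -b j i) :
    fderiv ℝ φ x v = ∑ i, p i * fderiv ℝ (hessianForm u) x v (e i) (e i) ∧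
    ∑ i, p i * (fderiv ℝ (fderiv ℝ (hessianForm u)) x v v (e i) (e i) + ∑ j,
      (4 * (b j i * fderiv ℝ (hessianForm u) x v (e j) (e i)) + 2 * (b j i ^ 2 * (μ j - μ i))))
      ≤ fderiv ℝ (fderiv ℝ φ) x v v := by
  obtain ⟨B, hBs, hB⟩ := exists_skewAdjoint e hb
  have hu2 : ContDiffAt ℝ 2 u x := hu.of_le two_le_smooth
  have hH2 : ContDiffAt ℝ 2 (hessianForm u) x :=
    (contDiffAt_hessianForm hu).of_le two_le_smooth
  have hc : Filter.Tendsto (fun t : ℝ => x + t • v) (𝓝 0) (𝓝 x) := by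
    have : Continuous fun t : ℝ => x + t • v := by fun_prop
    simpa using this.tendsto 0
  let ψ : Fin n → ℝ → ℝ := fun i t => hessianForm u (x + t • v) (NormedSpace.exp (t • B) (e i))
    (NormedSpace.exp (t • B) (e i))
  have hee : ∀ i j, inner ℝ (e i) (e j) = if i = j then (1 : ℝ) else 0 := fun i j =>
    orthonormal_iff_ite.1 e.orthonormal i j
  have hbii : ∀ i, b i i = 0 := fun i => by linarith [hb i i]
  have hψ : ∀ i, HasSecondDerivAtZero (ψ i) (fderiv ℝ (hessianForm u) x v (e i) (e i))
      (fderiv ℝ (fderiv ℝ (hessianForm u)) x v v (e i) (e i) + ∑ j,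
      (4 * (b j i * fderiv ℝ (hessianForm u) x v (e j) (e i)) + 2 * (b j i ^ 2 * (μ j - μ i)))) := by
    intro i
    have h1 := ((hasSecondDerivAtZero_line hH2 v).clm_apply
      (hasSecondDerivAtZero_exp B (e i))).clm_apply (hasSecondDerivAtZero_exp B (e i))
    refine h1.congr_values ?_ ?_
    · simp only [NormedSpace.exp_zero, one_apply_eq_self, zero_smul, add_zero, _root_.add_apply, hB, map_sum,
        map_smul, _root_.sum_apply, _root_.smul_apply, he, inner_sum, inner_smul_right, hee]
      simp [hbii]
    · have hHBB : hessianForm u x (e i) (B (B (e i))) = -∑ j, b j i ^ 2 * μ i := by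
        simp only [hB, map_sum, map_smul, he, inner_sum, inner_smul_right, hee]
        simp only [mul_ite, mul_one, mul_zero, Finset.sum_ite_eq, Finset.mem_univ,
          if_true, ← Finset.sum_neg_distrib, Finset.mul_sum]
        refine Finset.sum_congr rfl fun j _ => ?_
        rw [hb i j]
        ring
      have hBBH : hessianForm u x (B (B (e i))) (e i) = -∑ j, b j i ^ 2 * μ i := by
        rw [← hHBB]
        exact (hu2.isSymmSndFDerivAt (by simp)) _ _
      have hBHB : hessianForm u x (B (e i)) (B (e i)) = ∑ j, b j i ^ 2 * μ j := by
        simp only [hB, map_sum, map_smul, _root_.sum_apply, _root_.smul_apply, he, hee]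
        simp only [smul_eq_mul, mul_ite, mul_one, mul_zero, Finset.sum_ite_eq',
          Finset.mem_univ, if_true]
        exact Finset.sum_congr rfl fun j _ => by ring
      have hT : fderiv ℝ (hessianForm u) x v (B (e i)) (e i)
          = ∑ j, b j i * fderiv ℝ (hessianForm u) x v (e j) (e i) := by
        simp only [hB, map_sum, map_smul, _root_.sum_apply, _root_.smul_apply, smul_eq_mul]
      have hT' := (thirdDeriv_symm_right hu v (e i) (B (e i))).trans hT
      simp only [NormedSpace.exp_zero, one_apply_eq_self, zero_smul, add_zero, _root_.add_apply, two_smul,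
        hHBB, hBBH, hBHB, hT, hT']
      simp only [mul_sub, Finset.sum_add_distrib, Finset.sum_sub_distrib, ← Finset.mul_sum]
      ring
  have hline := hasSecondDerivAtZero_line hφ v
  have h := hline.of_touching
    (HasSecondDerivAtZero.const_mul_sum Finset.univ p fun i _ => hψ i) (by
      simp only [ψ, NormedSpace.exp_zero, one_apply_eq_self, zero_smul, add_zero, he, hee, hφx]
      rw [hessianFunction_eq hf hs hu2 he, ← hpμ]
      simp) (by
      filter_upwards [hc.eventually hle, hc.eventually (hu2.eventually (by simp))] with t ht ht'
      obtain ⟨q, hq⟩ := exists_rotated_basis e hBs t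
      refine le_trans ?_ ht
      have h2 := sum_mul_diag_le_hessianFunction hf hs hp ht' q
      simpa only [hq] using h2)
  exact h

/-! ### The algebraic inequalities. -/

section Algebra

variable {ι : Type*}

/-- The divided differences `(pᵢ - pⱼ) / (μᵢ - μⱼ)`. -/
def slope₂ (p μ : ι → ℝ) (i j : ι) : ℝ := (p i - p j) / (μ i - μ j)

theorem slope₂_comm (p μ : ι → ℝ) (i j : ι) : slope₂ p μ i j = slope₂ p μ j i := by
  rw [slope₂, slope₂, ← neg_sub (p j), ← neg_sub (μ j), neg_div_neg_eq]

theorem slope₂_self (p μ : ι → ℝ) (i : ι) : slope₂ p μ i i = 0 := by simp [slope₂]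

theorem slope₂_nonneg {p μ : ι → ℝ} (hm : ∀ i j, 0 ≤ (p i - p j) * (μ i - μ j)) (i j : ι) :
    0 ≤ slope₂ p μ i j := by
  rcases eq_or_ne (μ i - μ j) 0 with h | h
  · simp [slope₂, h]
  · have : slope₂ p μ i j = (p i - p j) * (μ i - μ j) / (μ i - μ j) ^ 2 := by
      rw [slope₂]; field_simp
    rw [this]
    exact div_nonneg (hm i j) (sq_nonneg _)

/-- Equality of `p` wherever `μ` coincides makes the convention a/0 = 0 harmless. -/
theorem slope₂_mul {p μ : ι → ℝ} (he : ∀ i j, μ i = μ j → p i = p j) (i j : ι) :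
    slope₂ p μ i j * (μ i - μ j) = p i - p j := by
  rcases eq_or_ne (μ i) (μ j) with h | h
  · simp [h, he i j h]
  · rw [slope₂, div_mul_cancel₀ _ (sub_ne_zero.2 h)]

/-- The optimal infinitesimal rotation and the resulting second variation. -/
theorem second_variation_eq [Fintype ι] (p μ : ι → ℝ) {T : ι → ι → ℝ} (hT : ∀ i j, T i j = T j i) :
    ∑ i, p i * ∑ j, (4 * (T i j / (μ i - μ j) * T j i)
      + 2 * ((T i j / (μ i - μ j)) ^ 2 * (μ j - μ i)))
      = ∑ i, ∑ j, slope₂ p μ i j * T i j ^ 2 := by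
  have h1 : ∀ i j, p i * (4 * (T i j / (μ i - μ j) * T j i)
      + 2 * ((T i j / (μ i - μ j)) ^ 2 * (μ j - μ i))) = 2 * (p i / (μ i - μ j) * T i j ^ 2) := by
    intro i j
    rw [hT j i]
    rcases eq_or_ne (μ i - μ j) 0 with h | h
    · simp [h]
    · rw [← neg_sub (μ i) (μ j)]
      field_simp
      ring
  -- Exchanging i and j, with T symmetric and the denominator odd, replaces pᵢ by -pⱼ; averaging the
  -- two forms produces the slopes.
  have h2 : ∑ i, ∑ j, p i / (μ i - μ j) * T i j ^ 2
      = ∑ i, ∑ j, -(p j / (μ i - μ j) * T i j ^ 2) := by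
    rw [Finset.sum_comm]
    refine Finset.sum_congr rfl fun j _ => Finset.sum_congr rfl fun i _ => ?_
    rw [hT i j, ← neg_sub (μ j) (μ i), div_neg]
    ring
  calc _ = ∑ i, ∑ j, 2 * (p i / (μ i - μ j) * T i j ^ 2) := by
        simp only [Finset.mul_sum, h1]
    _ = ∑ i, ∑ j, p i / (μ i - μ j) * T i j ^ 2 + ∑ i, ∑ j, p i / (μ i - μ j) * T i j ^ 2 := by
        simp only [← Finset.mul_sum]
        ring
    _ = ∑ i, ∑ j, p i / (μ i - μ j) * T i j ^ 2
        + ∑ i, ∑ j, -(p j / (μ i - μ j) * T i j ^ 2) := by rw [← h2]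
    _ = _ := by
        simp only [← Finset.sum_add_distrib, slope₂]
        refine Finset.sum_congr rfl fun i _ => Finset.sum_congr rfl fun j _ => ?_
        ring

section Monotone

variable {p μ : ι → ℝ} (s : Finset ι)

/-- Chebyshev's identity: the cross terms of the expanded product vanish because `μ` sums to zero.
-/
theorem card_mul_sum_eq_sum_sum (hμ : ∑ i ∈ s, μ i = 0) :
    2 * (s.card * ∑ i ∈ s, p i * μ i) = ∑ j ∈ s, ∑ i ∈ s, (p i - p j) * (μ i - μ j) := by
  have h1 : ∀ i j, (p i - p j) * (μ i - μ j)
      = p i * μ i + p j * μ j - p i * μ j - p j * μ i := fun i j => by ring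
  simp only [h1, Finset.sum_sub_distrib, Finset.sum_add_distrib, ← Finset.mul_sum, hμ,
    Finset.sum_const, nsmul_eq_mul, ← Finset.sum_mul]
  have h2 : ∑ i ∈ s, p i * (s.card * μ i) = s.card * ∑ i ∈ s, p i * μ i := by
    rw [Finset.mul_sum]
    exact Finset.sum_congr rfl fun _ _ => by ring
  rw [h2]
  ring

theorem sum_mul_nonneg_of_monotone (hm : ∀ i j, 0 ≤ (p i - p j) * (μ i - μ j))
    (hμ : ∑ i ∈ s, μ i = 0) : 0 ≤ s.card * ∑ i ∈ s, p i * μ i := by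
  have h1 := card_mul_sum_eq_sum_sum (p := p) s hμ
  have h2 : 0 ≤ ∑ j ∈ s, ∑ i ∈ s, (p i - p j) * (μ i - μ j) :=
    Finset.sum_nonneg fun j _ => Finset.sum_nonneg fun i _ => hm i j
  linarith

/-- In the nonnegative double sum of `card_mul_sum_eq_sum_sum`, the pairs containing `l` occur once
as a row and once as a column, which matches the factor 2 there. -/
theorem sum_sub_mul_sub_le [DecidableEq ι] (hm : ∀ i j, 0 ≤ (p i - p j) * (μ i - μ j))
    (hμ : ∑ i ∈ s, μ i = 0) {l : ι} (hl : l ∈ s) :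
    ∑ i ∈ s, (p i - p l) * (μ i - μ l) ≤ s.card * ∑ i ∈ s, p i * μ i := by
  have h1 := card_mul_sum_eq_sum_sum (p := p) s hμ
  rw [← Finset.add_sum_erase s (fun j => ∑ i ∈ s, (p i - p j) * (μ i - μ j)) hl] at h1
  have h2 : ∑ j ∈ s.erase l, (p l - p j) * (μ l - μ j)
      ≤ ∑ j ∈ s.erase l, ∑ i ∈ s, (p i - p j) * (μ i - μ j) :=
    Finset.sum_le_sum fun j _ => Finset.single_le_sum
      (f := fun i => (p i - p j) * (μ i - μ j)) (fun i _ => hm i j) hl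
  have h3 : ∑ j ∈ s.erase l, (p l - p j) * (μ l - μ j) = ∑ i ∈ s, (p i - p l) * (μ i - μ l) := by
    rw [← Finset.add_sum_erase s _ hl]
    simp only [sub_self, mul_zero, zero_add]
    exact Finset.sum_congr rfl fun j _ => by ring
  linarith

/-- As `t` sums to zero, pᵢ may be replaced by pᵢ-pₗ. Then Cauchy–Schwarz applies to the splitting
of (pᵢ-pₗ)²tᵢ² as (pᵢ-pₗ)(μᵢ-μₗ) times sᵢₗtᵢ². -/
theorem sum_mul_sq_le [DecidableEq ι] (hm : ∀ i j, 0 ≤ (p i - p j) * (μ i - μ j))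
    (he : ∀ i j, μ i = μ j → p i = p j) (hμ : ∑ i ∈ s, μ i = 0) {l : ι} (hl : l ∈ s)
    {t : ι → ℝ} (ht : ∑ i ∈ s, t i = 0) :
    (∑ i ∈ s, p i * t i) ^ 2
      ≤ (s.card * ∑ i ∈ s, p i * μ i) * ∑ i ∈ s, slope₂ p μ i l * t i ^ 2 := by
  have h1 : ∑ i ∈ s, p i * t i = ∑ i ∈ s, (p i - p l) * t i := by
    simp only [sub_mul, Finset.sum_sub_distrib, ← Finset.mul_sum, ht]
    ring
  have h2 : ∀ i ∈ s, 0 ≤ slope₂ p μ i l * t i ^ 2 := fun i _ =>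
    mul_nonneg (slope₂_nonneg hm i l) (sq_nonneg _)
  rw [h1]
  refine (Finset.sum_sq_le_sum_mul_sum_of_sq_le_mul s (fun i _ => hm i l) h2
    fun i _ => ?_).trans ?_
  · rw [← slope₂_mul he i l]
    apply le_of_eq
    ring
  · exact mul_le_mul_of_nonneg_right (sum_sub_mul_sub_le s hm hμ hl) (Finset.sum_nonneg h2)

/-- For each ordered pair i ≠ j keep only k = i and k = j. Symmetry of T turns these terms into
Tᵢᵢⱼ² + Tⱼⱼᵢ², and both halves have the same sum. -/
theorem two_mul_sum_sum_slope_le [DecidableEq ι] (hm : ∀ i j, 0 ≤ (p i - p j) * (μ i - μ j))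
    {T : ι → ι → ι → ℝ} (hT₁ : ∀ i j k, T i j k = T j i k) (hT₂ : ∀ i j k, T i j k = T i k j) :
    2 * ∑ l ∈ s, ∑ i ∈ s, slope₂ p μ i l * T i i l ^ 2
      ≤ ∑ k ∈ s, ∑ i ∈ s, ∑ j ∈ s, slope₂ p μ i j * T i j k ^ 2 := by
  have h1 : ∀ i ∈ s, ∀ j ∈ s, slope₂ p μ i j * (T i i j ^ 2 + T j j i ^ 2)
      ≤ ∑ k ∈ s, slope₂ p μ i j * T i j k ^ 2 := by
    intro i hi j hj
    rcases eq_or_ne i j with rfl | hij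
    · simp [slope₂_self]
    · rw [← Finset.mul_sum]
      refine mul_le_mul_of_nonneg_left ?_ (slope₂_nonneg hm i j)
      have h2 : ∑ k ∈ ({i, j} : Finset ι), T i j k ^ 2 ≤ ∑ k ∈ s, T i j k ^ 2 :=
        Finset.sum_le_sum_of_subset_of_nonneg (by
          intro a ha
          rcases Finset.mem_insert.1 ha with rfl | ha
          · exact hi
          · rw [Finset.mem_singleton.1 ha]; exact hj) fun _ _ _ => sq_nonneg _
      rw [Finset.sum_pair hij] at h2
      rwa [hT₂ i i j, hT₂ j j i, hT₁ j i j]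
  have h3 : ∑ k ∈ s, ∑ i ∈ s, ∑ j ∈ s, slope₂ p μ i j * T i j k ^ 2
      = ∑ i ∈ s, ∑ j ∈ s, ∑ k ∈ s, slope₂ p μ i j * T i j k ^ 2 := by
    rw [Finset.sum_comm]
    exact Finset.sum_congr rfl fun i _ => Finset.sum_comm
  rw [h3]
  refine le_trans (le_of_eq ?_)
    (Finset.sum_le_sum fun i hi => Finset.sum_le_sum fun j hj => h1 i hi j hj)
  simp only [mul_add, Finset.sum_add_distrib]
  rw [two_mul]
  congr 1
  · exact Finset.sum_comm
  · exact Finset.sum_congr rfl fun i _ => Finset.sum_congr rfl fun j _ => by rw [slope₂_comm]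

/-- The algebraic inequality behind `w Δw ≥ (2/n) |∇w|²`. -/
theorem two_mul_sum_sq_le [DecidableEq ι] (hm : ∀ i j, 0 ≤ (p i - p j) * (μ i - μ j))
    (he : ∀ i j, μ i = μ j → p i = p j) (hμ : ∑ i ∈ s, μ i = 0)
    {T : ι → ι → ι → ℝ} (hT₁ : ∀ i j k, T i j k = T j i k) (hT₂ : ∀ i j k, T i j k = T i k j)
    (htr : ∀ l ∈ s, ∑ i ∈ s, T i i l = 0) :
    2 * ∑ l ∈ s, (∑ i ∈ s, p i * T i i l) ^ 2 ≤ (s.card * ∑ i ∈ s, p i * μ i)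
      * ∑ k ∈ s, ∑ i ∈ s, ∑ j ∈ s, slope₂ p μ i j * T i j k ^ 2 := by
  have h1 : ∑ l ∈ s, (∑ i ∈ s, p i * T i i l) ^ 2 ≤ (s.card * ∑ i ∈ s, p i * μ i)
      * ∑ l ∈ s, ∑ i ∈ s, slope₂ p μ i l * T i i l ^ 2 := by
    rw [Finset.mul_sum]
    exact Finset.sum_le_sum fun l hl => sum_mul_sq_le s hm he hμ hl (htr l hl)
  have h2 := mul_le_mul_of_nonneg_left (two_mul_sum_sum_slope_le s hm hT₁ hT₂)
    (sum_mul_nonneg_of_monotone s hm hμ)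
  linarith

end Monotone

/-- The decomposition of the second variation when the third derivatives in one direction are
determined by the second ones. -/
theorem sum_slope_eq_erase [Fintype ι] [DecidableEq ι] {p μ : ι → ℝ}
    (he : ∀ i j, μ i = μ j → p i = p j) (hμ : ∑ i, μ i = 0)
    {T : ι → ι → ι → ℝ} (hT₁ : ∀ i j k, T i j k = T j i k) (hT₂ : ∀ i j k, T i j k = T i k j)
    {m : ι} (hμm : μ m = 0) {α : ℝ} (hTm : ∀ i j, T i j m = if i = j then -α * μ i else 0) :
    ∑ k, ∑ i, ∑ j, slope₂ p μ i j * T i j k ^ 2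
      = ∑ k ∈ Finset.univ.erase m, ∑ i ∈ Finset.univ.erase m, ∑ j ∈ Finset.univ.erase m,
          slope₂ p μ i j * T i j k ^ 2 + 2 * α ^ 2 * ∑ i, p i * μ i := by
  have h0 : ∑ i, ∑ j, slope₂ p μ i j * T i j m ^ 2 = 0 := by
    refine Finset.sum_eq_zero fun i _ => Finset.sum_eq_zero fun j _ => ?_
    rcases eq_or_ne i j with rfl | hij
    · simp [slope₂_self]
    · simp [hTm, hij]
  -- Only i = k survives, and sₖₘμₖ = pₖ-pₘ because μₘ = 0.
  have h1 : ∀ k, ∑ i, slope₂ p μ i m * T i m k ^ 2 = α ^ 2 * ((p k - p m) * μ k) := by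
    intro k
    rw [Finset.sum_eq_single k]
    · rw [hT₂, hTm, if_pos rfl, ← slope₂_mul he k m, hμm]
      ring
    · intro i _ hik
      rw [hT₂, hTm, if_neg hik]
      ring
    · simp
  have h2 : ∀ k, ∑ i, ∑ j, slope₂ p μ i j * T i j k ^ 2
      = ∑ i ∈ Finset.univ.erase m, ∑ j ∈ Finset.univ.erase m, slope₂ p μ i j * T i j k ^ 2
        + 2 * (α ^ 2 * ((p k - p m) * μ k)) := by
    intro k
    have h3 : ∀ i, ∑ j, slope₂ p μ i j * T i j k ^ 2
        = slope₂ p μ i m * T i m k ^ 2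
          + ∑ j ∈ Finset.univ.erase m, slope₂ p μ i j * T i j k ^ 2 := fun i =>
      (Finset.add_sum_erase _ _ (Finset.mem_univ m)).symm
    simp only [h3, Finset.sum_add_distrib, h1]
    rw [← Finset.add_sum_erase _ (fun i => ∑ j ∈ Finset.univ.erase m, slope₂ p μ i j * T i j k ^ 2)
      (Finset.mem_univ m)]
    have h4 : ∑ j ∈ Finset.univ.erase m, slope₂ p μ m j * T m j k ^ 2
        = α ^ 2 * ((p k - p m) * μ k) := by
      rw [← h1 k, ← Finset.add_sum_erase _ _ (Finset.mem_univ m), slope₂_self, zero_mul, zero_add]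
      exact Finset.sum_congr rfl fun j _ => by rw [slope₂_comm, hT₁]
    rw [h4]
    ring
  rw [← Finset.add_sum_erase _ _ (Finset.mem_univ m), h0, zero_add]
  simp only [h2, Finset.sum_add_distrib]
  congr 1
  have h5 : ∑ k ∈ Finset.univ.erase m, 2 * (α ^ 2 * ((p k - p m) * μ k))
      = ∑ k, 2 * (α ^ 2 * ((p k - p m) * μ k)) := by
    rw [← Finset.add_sum_erase _ _ (Finset.mem_univ m)]
    simp
  rw [h5]
  simp only [← Finset.mul_sum, sub_mul, Finset.sum_sub_distrib, hμ]
  ring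

end Algebra

/-! ### Traces of derivatives and the touching inequality. -/

theorem hasFDerivAt_apply_const {W : Type*} [NormedAddCommGroup W] [NormedSpace ℝ W]
    {G : E n → E n →L[ℝ] W} {x : E n} {G' : E n →L[ℝ] E n →L[ℝ] W} (hG : HasFDerivAt G G' x)
    (a : E n) : HasFDerivAt (fun y => G y a) (G'.flip a) x := by
  convert! hG.clm_apply (hasFDerivAt_const a x) using 1
  ext v
  simp

theorem sum_hessianForm_eq_zero {u : E n → ℝ} {x : E n} (hu : InnerProductSpace.HarmonicAt u x)
    (e : OrthonormalBasis (Fin n) ℝ (E n)) : ∑ i, hessianForm u x (e i) (e i) = 0 := by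
  rw [← laplacian_eq_sum_fderiv]
  exact hu.2.self_of_nhds

theorem sum_thirdDeriv_eq_zero {u : E n → ℝ} {x : E n} (hu : InnerProductSpace.HarmonicAt u x)
    (e : OrthonormalBasis (Fin n) ℝ (E n)) (v : E n) :
    ∑ i, fderiv ℝ (hessianForm u) x v (e i) (e i) = 0 := by
  have hd := ((contDiffAt_hessianForm (contDiffAt_of_harmonicAt hu)).differentiableAt
    (by simp)).hasFDerivAt
  have h1 := HasFDerivAt.fun_sum (u := Finset.univ)
    fun i _ => hasFDerivAt_apply_const (hasFDerivAt_apply_const hd (e i)) (e i)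
  have h2 : (fun y => ∑ i, hessianForm u y (e i) (e i)) =ᶠ[𝓝 x] fun _ => 0 := by
    filter_upwards [hu.eventually] with y hy using sum_hessianForm_eq_zero hy e
  have h3 := h1.unique ((hasFDerivAt_const 0 x).congr_of_eventuallyEq h2)
  simpa using DFunLike.congr_fun h3 v

-- By symmetry of the fourth derivatives, this is the derivative in direction `a` of a trace of
-- third derivatives, which vanishes near `x`.
set_option maxSynthPendingDepth 3 in
theorem sum_fourthDeriv_eq_zero {u : E n → ℝ} {x : E n} (hu : InnerProductSpace.HarmonicAt u x)
    (e : OrthonormalBasis (Fin n) ℝ (E n)) (a : E n) :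
    ∑ k, fderiv ℝ (fderiv ℝ (hessianForm u)) x (e k) (e k) a a = 0 := by
  have hH := contDiffAt_hessianForm (contDiffAt_of_harmonicAt hu)
  have hd := (((hH.fderiv_right (m := (⊤ : ℕ∞)) (by simp))).differentiableAt
    (by simp)).hasFDerivAt
  have hap : ∀ a b c : E n, HasFDerivAt (fun y => fderiv ℝ (hessianForm u) y a b c)
      ((((fderiv ℝ (fderiv ℝ (hessianForm u)) x).flip a).flip b).flip c) x := fun a b c =>
    hasFDerivAt_apply_const (hasFDerivAt_apply_const (hasFDerivAt_apply_const hd a) b) c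
  have hsymm : ∀ v a b c : E n, fderiv ℝ (fderiv ℝ (hessianForm u)) x v a b c
      = fderiv ℝ (fderiv ℝ (hessianForm u)) x v b a c := by
    intro v a b c
    have h1 : (fun y => fderiv ℝ (hessianForm u) y a b c) =ᶠ[𝓝 x]
        fun y => fderiv ℝ (hessianForm u) y b a c := by
      filter_upwards [hu.eventually] with y hy using
        thirdDeriv_symm_left (contDiffAt_of_harmonicAt hy) a b c
    simpa using DFunLike.congr_fun ((hap a b c).unique ((hap b a c).congr_of_eventuallyEq h1)) v
  have h1 := HasFDerivAt.fun_sum (u := Finset.univ) fun i _ => hap (e i) (e i) a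
  have h2 : (fun y => ∑ i, fderiv ℝ (hessianForm u) y (e i) (e i) a) =ᶠ[𝓝 x] fun _ => 0 := by
    filter_upwards [hu.eventually] with y hy
    have hs := contDiffAt_of_harmonicAt hy
    rw [← sum_thirdDeriv_eq_zero hy e a]
    exact Finset.sum_congr rfl fun i _ => by
      rw [thirdDeriv_symm_right hs, thirdDeriv_symm_left hs]
  have h3 := h1.unique ((hasFDerivAt_const 0 x).congr_of_eventuallyEq h2)
  have h4 : ∑ k, fderiv ℝ (fderiv ℝ (hessianForm u)) x a (e k) (e k) a = 0 := by
    simpa using DFunLike.congr_fun h3 a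
  rw [← h4]
  refine Finset.sum_congr rfl fun k _ => ?_
  have h5 := ((hH.of_le two_le_smooth).isSymmSndFDerivAt (by simp)) a (e k)
  rw [h5, hsymm (e k) (e k) a a]

/-- The third derivatives of `u` in an orthonormal basis. -/
def thirdDeriv (u : E n → ℝ) (x : E n) (e : OrthonormalBasis (Fin n) ℝ (E n)) (i j k : Fin n) : ℝ :=
  fderiv ℝ (hessianForm u) x (e k) (e i) (e j)

theorem thirdDeriv_comm_left {u : E n → ℝ} {x : E n} (hu : ContDiffAt ℝ (⊤ : ℕ∞) u x)
    (e : OrthonormalBasis (Fin n) ℝ (E n)) (i j k : Fin n) :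
    thirdDeriv u x e i j k = thirdDeriv u x e j i k :=
  thirdDeriv_symm_right hu _ _ _

theorem thirdDeriv_comm_right {u : E n → ℝ} {x : E n} (hu : ContDiffAt ℝ (⊤ : ℕ∞) u x)
    (e : OrthonormalBasis (Fin n) ℝ (E n)) (i j k : Fin n) :
    thirdDeriv u x e i j k = thirdDeriv u x e i k j := by
  rw [thirdDeriv, thirdDeriv, thirdDeriv_symm_right hu, thirdDeriv_symm_left hu,
    thirdDeriv_symm_right hu]

set_option maxSynthPendingDepth 3 in
/-- The differential inequalities satisfied by functions touching `w` from above. -/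
theorem touching_inequality {f : (Fin n → ℝ) → ℝ} (hf : ConvexOn ℝ Set.univ f)
    (hs : IsSymmetricFun f) {u : E n → ℝ} {x : E n} (hu : InnerProductSpace.HarmonicAt u x)
    {e : OrthonormalBasis (Fin n) ℝ (E n)} {μ : Fin n → ℝ}
    (he : ∀ i w, hessianForm u x (e i) w = μ i * inner ℝ (e i) w)
    {p : Fin n → ℝ} (hp : ∀ m, ∑ i, p i * m i ≤ f m) (hpμ : ∑ i, p i * μ i = f μ)
    {φ : E n → ℝ} (hφ : ContDiffAt ℝ 2 φ x) (hφx : φ x = hessianFunction f u x)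
    (hle : ∀ᶠ y in 𝓝 x, hessianFunction f u y ≤ φ y) :
    (∀ k, fderiv ℝ φ x (e k) = ∑ i, p i * thirdDeriv u x e i i k) ∧
    ∑ k, ∑ i, ∑ j, slope₂ p μ i j * thirdDeriv u x e i j k ^ 2 ≤ Δ φ x := by
  have hsm := contDiffAt_of_harmonicAt hu
  -- This rotation maximises the quadratic expression in `b` of `touching_along_line`: per pair it
  -- is (pᵢ-pⱼ)(4βT - 2β²(μᵢ-μⱼ)) with β = bⱼᵢ. For equal eigenvalues the quotient defaults to 0.
  have hline := fun k => touching_along_line hf hs hsm he hp hpμ hφ hφx hle (e k)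
    (b := fun i j => thirdDeriv u x e j i k / (μ j - μ i)) fun i j => by
      rw [thirdDeriv_comm_left hsm, ← neg_sub (μ i), div_neg]
  refine ⟨fun k => (hline k).1, ?_⟩
  rw [laplacian_eq_sum_fderiv e]
  have h4 : ∑ k, ∑ i, p i * fderiv ℝ (fderiv ℝ (hessianForm u)) x (e k) (e k) (e i) (e i) = 0 := by
    rw [Finset.sum_comm]
    refine Finset.sum_eq_zero fun i _ => ?_
    rw [← Finset.mul_sum, sum_fourthDeriv_eq_zero hu, mul_zero]
  have h5 : ∀ k ∈ Finset.univ,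
      ∑ i, p i * fderiv ℝ (fderiv ℝ (hessianForm u)) x (e k) (e k) (e i) (e i)
        + ∑ i, ∑ j, slope₂ p μ i j * thirdDeriv u x e i j k ^ 2
        ≤ fderiv ℝ (fderiv ℝ φ) x (e k) (e k) := fun k _ => by
    refine le_trans (le_of_eq ?_) (hline k).2
    rw [← second_variation_eq p μ fun i j => thirdDeriv_comm_left hsm e i j k,
      ← Finset.sum_add_distrib]
    refine Finset.sum_congr rfl fun i _ => ?_
    rw [← mul_add]
    rfl
  have h6 := Finset.sum_le_sum h5
  rwa [Finset.sum_add_distrib, h4, zero_add] at h6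

theorem norm_gradient_sq_eq_sum (e : OrthonormalBasis (Fin n) ℝ (E n)) (φ : E n → ℝ) (x : E n) :
    ‖∇ φ x‖ ^ 2 = ∑ k, fderiv ℝ φ x (e k) ^ 2 := by
  rw [← e.sum_sq_norm_inner_left]
  simp [gradient]

/-! ### Adapted eigenbases and homogeneity. -/

/-- Symmetric bilinear forms have orthonormal eigenbases. -/
theorem exists_eigenbasis {K : E n →L[ℝ] E n →L[ℝ] ℝ} (hK : ∀ v w, K v w = K w v) :
    ∃ (e : OrthonormalBasis (Fin n) ℝ (E n)) (μ : Fin n → ℝ),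
      ∀ i w, K (e i) w = μ i * inner ℝ (e i) w := by
  let A : E n →ₗ[ℝ] E n :=
    ((InnerProductSpace.toDual ℝ (E n)).symm.toLinearEquiv.toLinearMap).comp K.toLinearMap
  have hA : ∀ v w, inner ℝ (A v) w = K v w := fun v w => by
    simp [A]
  have hs : A.IsSymmetric := fun v w => by
    rw [hA, real_inner_comm, hA, hK]
  refine ⟨hs.eigenvectorBasis (by simp), hs.eigenvalues (by simp), fun i w => ?_⟩
  rw [← hA, hs.apply_eigenvectorBasis, inner_smul_left]
  simp

/-- A symmetric bilinear form has an orthonormal eigenbasis containing a multiple of a given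
null vector. -/
theorem exists_eigenbasis_of_null {H : E n →L[ℝ] E n →L[ℝ] ℝ} (hH : ∀ v w, H v w = H w v)
    {x : E n} (hx : x ≠ 0) (hHx : ∀ v, H v x = 0) :
    ∃ (e : OrthonormalBasis (Fin n) ℝ (E n)) (μ : Fin n → ℝ) (m : Fin n) (α : ℝ),
      (∀ i w, H (e i) w = μ i * inner ℝ (e i) w) ∧ e m = α • x ∧ μ m = 0 := by
  have hx2 : 0 < ‖x‖ ^ 2 := by positivity
  -- The added rank-one term gives `x` the eigenvalue ‖H‖+1, too large for `H` itself. This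
  -- eigenvalue is therefore simple, and an eigenvector not orthogonal to `x` must be parallel to
  -- it.
  let c : ℝ := (‖H‖ + 1) / ‖x‖ ^ 2
  have hc : c * ‖x‖ ^ 2 = ‖H‖ + 1 := div_mul_cancel₀ _ hx2.ne'
  let K : E n →L[ℝ] E n →L[ℝ] ℝ := H + (innerSL ℝ x).smulRight (c • innerSL ℝ x)
  have hK : ∀ v w, K v w = H v w + c * (inner ℝ x v * inner ℝ x w) := fun v w => by
    simp [K]
    ring
  obtain ⟨e, μ, he⟩ := exists_eigenbasis (K := K) fun v w => by
    rw [hK, hK, hH, mul_comm (inner ℝ x v)]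
  have hpar : ∀ i, inner ℝ x (e i) ≠ 0 → e i = (inner ℝ x (e i) / ‖x‖ ^ 2) • x := by
    intro i hi
    set z := e i - (inner ℝ x (e i) / ‖x‖ ^ 2) • x with hz
    have h1 : μ i = ‖H‖ + 1 := by
      have h2 := he i x
      rw [hK, hHx, zero_add, real_inner_self_eq_norm_sq, real_inner_comm x (e i)] at h2
      rw [← hc]
      apply mul_right_cancel₀ hi
      linarith
    have h2 : H z z = (‖H‖ + 1) * ‖z‖ ^ 2 := by
      have h3 : H z z = H (e i) (e i) := by
        rw [hz]
        simp [hHx, hH x]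
      have h4 := he i (e i)
      rw [hK, h1] at h4
      have h5 : ‖z‖ ^ 2 = inner ℝ (e i) (e i) - inner ℝ x (e i) ^ 2 / ‖x‖ ^ 2 := by
        rw [← real_inner_self_eq_norm_sq, hz]
        simp only [inner_sub_left, inner_sub_right, inner_smul_left, inner_smul_right,
          conj_trivial, real_inner_self_eq_norm_sq x, real_inner_comm x (e i)]
        field_simp
        ring
      rw [h3, h5]
      have h6 : c = (‖H‖ + 1) / ‖x‖ ^ 2 := rfl
      rw [h6] at h4
      linear_combination h4
    have h3 : H z z ≤ ‖H‖ * ‖z‖ ^ 2 := by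
      have := (le_abs_self _).trans (H.le_opNorm₂ z z)
      rw [mul_assoc, ← sq] at this
      exact this
    have h4 : ‖z‖ ^ 2 ≤ 0 := by linarith
    have h5 : z = 0 := by
      rw [← norm_eq_zero]
      exact pow_eq_zero_iff (two_ne_zero) |>.1 (le_antisymm h4 (sq_nonneg _))
    exact sub_eq_zero.1 h5
  have hex : ∃ m, inner ℝ x (e m) ≠ 0 := by
    by_contra! h
    have h1 := e.sum_sq_norm_inner_left x
    simp [h] at h1
    exact hx2.ne h1
  obtain ⟨m, hm⟩ := hex
  have hHm : ∀ i, inner ℝ x (e i) ≠ 0 → ∀ w, H (e i) w = 0 := fun i hi w => by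
    rw [hpar i hi, map_smul, smul_apply, hH, hHx, smul_zero]
  refine ⟨e, fun i => H (e i) (e i), m, _, fun i w => ?_, hpar m hm, hHm m hm _⟩
  by_cases hi : inner ℝ x (e i) = 0
  · have h1 : ∀ w, H (e i) w = μ i * inner ℝ (e i) w := fun w => by
      rw [← he, hK, hi]
      ring
    simp [h1]
  · simp only [hHm i hi, zero_mul]

section Homogeneous

variable {u : E n → ℝ} {Ω : Set (E n)}

/-- Euler's identity. -/
theorem fderiv_apply_self_of_homogeneous (hΩ : IsOpen Ω) (hh : IsHomogeneousOneOn u Ω) {x : E n}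
    (hx : x ∈ Ω) (hu : DifferentiableAt ℝ u x) : fderiv ℝ u x x = u x := by
  have h1 : HasDerivAt (fun t : ℝ => t • x) x 1 := by
    simpa using (hasDerivAt_id (1 : ℝ)).smul_const x
  have hc : Filter.Tendsto (fun t : ℝ => t • x) (𝓝 1) (𝓝 x) := by
    simpa using h1.continuousAt.tendsto
  have h2 : HasDerivAt (fun t : ℝ => u (t • x)) (fderiv ℝ u x x) 1 := by
    have h3 : HasFDerivAt u (fderiv ℝ u x) ((1 : ℝ) • x) := by simpa using hu.hasFDerivAt
    exact h3.comp_hasDerivAt 1 h1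
  have h4 : (fun t : ℝ => u (t • x)) =ᶠ[𝓝 1] fun t => t * u x := by
    filter_upwards [hc.eventually (hΩ.mem_nhds hx), lt_mem_nhds zero_lt_one] with t ht ht0
    exact hh x hx t ht0 ht
  have h5 : HasDerivAt (fun t : ℝ => t * u x) (u x) 1 := by
    simpa using (hasDerivAt_id (1 : ℝ)).mul_const (u x)
  exact h2.unique (h5.congr_of_eventuallyEq h4)

/-- Differentiate Euler's identity Du(y)y = u(y): the two first-order terms cancel. -/
theorem hessianForm_apply_self_of_homogeneous (hΩ : IsOpen Ω) (hh : IsHomogeneousOneOn u Ω)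
    (hu : ∀ x ∈ Ω, ContDiffAt ℝ (⊤ : ℕ∞) u x) {x : E n} (hx : x ∈ Ω) (v : E n) :
    hessianForm u x v x = 0 := by
  have h1 : (fun y => fderiv ℝ u y y) =ᶠ[𝓝 x] u := by
    filter_upwards [hΩ.mem_nhds hx] with y hy
    exact fderiv_apply_self_of_homogeneous hΩ hh hy ((hu y hy).differentiableAt (by simp))
  have h2 := ((((hu x hx).fderiv_right (m := (⊤ : ℕ∞)) (by simp)).differentiableAt
    (by simp)).hasFDerivAt).clm_apply (hasFDerivAt_id x)
  have h3 := h2.unique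
    (((hu x hx).differentiableAt (by simp)).hasFDerivAt.congr_of_eventuallyEq h1)
  have h4 := DFunLike.congr_fun h3 v
  simpa using h4

/-- Differentiate D²u(y)(v,y) = 0 in `y`. -/
theorem thirdDeriv_apply_self_of_homogeneous (hΩ : IsOpen Ω) (hh : IsHomogeneousOneOn u Ω)
    (hu : ∀ x ∈ Ω, ContDiffAt ℝ (⊤ : ℕ∞) u x) {x : E n} (hx : x ∈ Ω) (v w : E n) :
    fderiv ℝ (hessianForm u) x w v x = -hessianForm u x v w := by
  have h1 : (fun y => hessianForm u y v y) =ᶠ[𝓝 x] fun _ => 0 := by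
    filter_upwards [hΩ.mem_nhds hx] with y hy
    exact hessianForm_apply_self_of_homogeneous hΩ hh hu hy v
  have hd := ((contDiffAt_hessianForm (hu x hx)).differentiableAt (by simp)).hasFDerivAt
  have h2 := (hasFDerivAt_apply_const hd v).clm_apply (hasFDerivAt_id x)
  have h3 := h2.unique ((hasFDerivAt_const 0 x).congr_of_eventuallyEq h1)
  have h4 := DFunLike.congr_fun h3 w
  simp at h4
  linarith

end Homogeneous

/-! ### The two differential inequalities. -/

theorem sum_eigenvalues_eq_zero {u : E n → ℝ} {x : E n} (hu : InnerProductSpace.HarmonicAt u x)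
    {e : OrthonormalBasis (Fin n) ℝ (E n)} {μ : Fin n → ℝ}
    (he : ∀ i w, hessianForm u x (e i) w = μ i * inner ℝ (e i) w) : ∑ i, μ i = 0 := by
  rw [← sum_hessianForm_eq_zero hu e]
  exact Finset.sum_congr rfl fun i _ => by simp [he]

theorem mul_laplacian_ge_of_touching (hn : 1 ≤ n) {f : (Fin n → ℝ) → ℝ}
    (hf : ConvexOn ℝ Set.univ f) (hs : IsSymmetricFun f) (hh : IsHomogeneousOneOn f Set.univ)
    {u : E n → ℝ} {x : E n} (hu : InnerProductSpace.HarmonicAt u x)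
    {φ : E n → ℝ} (hφ : ContDiffAt ℝ 2 φ x) (hφx : φ x = hessianFunction f u x)
    (hle : ∀ᶠ y in 𝓝 x, hessianFunction f u y ≤ φ y) :
    2 / (n : ℝ) * ‖∇ φ x‖ ^ 2 ≤ hessianFunction f u x * Δ φ x := by
  have hsm := contDiffAt_of_harmonicAt hu
  obtain ⟨e, he⟩ := exists_eigenbasis_hessian hu.1
  obtain ⟨p, hp, hpμ, hpe⟩ := exists_subgradient hf hs hh (eigenvalues (hessian u x))
  set μ := eigenvalues (hessian u x) with hμdef
  have hm := subgradient_monotone hs hp hpμ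
  have hμ := sum_eigenvalues_eq_zero hu he
  obtain ⟨h1, h2⟩ := touching_inequality hf hs hu he hp hpμ hφ hφx hle
  have hw : hessianFunction f u x = ∑ i, p i * μ i := hpμ.symm
  have h3 := two_mul_sum_sq_le Finset.univ hm hpe hμ (thirdDeriv_comm_left hsm e)
    (thirdDeriv_comm_right hsm e) fun l _ => sum_thirdDeriv_eq_zero hu e (e l)
  -- Gives n·w ≥ 0, so the lower bound for Δφ may be multiplied by it.
  have h4 := sum_mul_nonneg_of_monotone Finset.univ hm hμ
  rw [norm_gradient_sq_eq_sum e]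
  simp only [h1]
  rw [Finset.card_univ, Fintype.card_fin, ← hw] at h3 h4
  have hn0 : (0 : ℝ) < n := by exact_mod_cast hn
  have h5 := h3.trans (mul_le_mul_of_nonneg_left h2 h4)
  rw [div_mul_eq_mul_div, div_le_iff₀ hn0]
  linarith

theorem mul_laplacian_ge_of_touching_of_homogeneous (hn : 2 ≤ n) {f : (Fin n → ℝ) → ℝ}
    (hf : ConvexOn ℝ Set.univ f) (hs : IsSymmetricFun f) (hh : IsHomogeneousOneOn f Set.univ)
    {u : E n → ℝ} {Ω : Set (E n)} (hΩ : IsOpen Ω) (hu : InnerProductSpace.HarmonicOnNhd u Ω)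
    (huh : IsHomogeneousOneOn u Ω) {x : E n} (hx : x ∈ Ω) (hx0 : x ≠ 0)
    {φ : E n → ℝ} (hφ : ContDiffAt ℝ 2 φ x) (hφx : φ x = hessianFunction f u x)
    (hle : ∀ᶠ y in 𝓝 x, hessianFunction f u y ≤ φ y) :
    2 / ((n : ℝ) - 1) * ‖∇ φ x‖ ^ 2
      + 2 * (((n : ℝ) - 2) / ((n : ℝ) - 1)) * (hessianFunction f u x ^ 2 / ‖x‖ ^ 2)
      ≤ hessianFunction f u x * Δ φ x := by
  have hsmΩ : ∀ y ∈ Ω, ContDiffAt ℝ (⊤ : ℕ∞) u y := fun y hy => contDiffAt_of_harmonicAt (hu y hy)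
  have hsm := hsmΩ x hx
  have hux := hu x hx
  obtain ⟨e, μ, m, α, he, hem, hμm⟩ := exists_eigenbasis_of_null
    (fun v w => (hux.1.isSymmSndFDerivAt (by simp)) v w) hx0
    (hessianForm_apply_self_of_homogeneous hΩ huh hsmΩ hx)
  obtain ⟨p, hp, hpμ, hpe⟩ := exists_subgradient hf hs hh μ
  have hm := subgradient_monotone hs hp hpμ
  have hμ := sum_eigenvalues_eq_zero hux he
  obtain ⟨h1, h2⟩ := touching_inequality hf hs hux he hp hpμ hφ hφx hle
  have hw : hessianFunction f u x = ∑ i, p i * μ i := by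
    rw [hpμ, hessianFunction_eq hf hs hux.1 he]
  have hT₁ := thirdDeriv_comm_left hsm e
  have hT₂ := thirdDeriv_comm_right hsm e
  have hα : 1 / ‖x‖ ^ 2 = α ^ 2 := by
    have h3 := e.norm_eq_one m
    rw [hem, norm_smul] at h3
    have h4 : α ^ 2 * ‖x‖ ^ 2 = 1 := by
      rw [← sq_abs α, ← Real.norm_eq_abs, ← mul_pow, h3, one_pow]
    rw [← h4, mul_div_assoc, div_self (by positivity), mul_one]
  have hTm : ∀ i j, thirdDeriv u x e i j m = if i = j then -α * μ i else 0 := by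
    intro i j
    rw [hT₂, thirdDeriv, hem, map_smul, thirdDeriv_apply_self_of_homogeneous hΩ huh hsmΩ hx, he,
      orthonormal_iff_ite.1 e.orthonormal]
    split_ifs <;> simp
  have herase : ∀ g : Fin n → ℝ, ∑ i, g i = g m + ∑ i ∈ Finset.univ.erase m, g i := fun g =>
    (Finset.add_sum_erase _ g (Finset.mem_univ m)).symm
  have hTmm : ∀ l ≠ m, thirdDeriv u x e m m l = 0 := fun l hl => by
    rw [hT₂, hTm, if_neg hl.symm]
  have hμ' : ∑ i ∈ Finset.univ.erase m, μ i = 0 := by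
    rw [herase, hμm, zero_add] at hμ
    exact hμ
  have htr : ∀ l ∈ Finset.univ.erase m, ∑ i ∈ Finset.univ.erase m, thirdDeriv u x e i i l = 0 := by
    intro l hl
    have h3 := sum_thirdDeriv_eq_zero hux e (e l)
    rw [herase] at h3
    change thirdDeriv u x e m m l + _ = 0 at h3
    rw [hTmm l (Finset.ne_of_mem_erase hl), zero_add] at h3
    exact h3
  have h3 := two_mul_sum_sq_le (Finset.univ.erase m) hm hpe hμ' hT₁ hT₂ htr
  have h4 := sum_mul_nonneg_of_monotone (Finset.univ.erase m) hm hμ'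
  have hw' : ∑ i ∈ Finset.univ.erase m, p i * μ i = hessianFunction f u x := by
    rw [hw, herase, hμm, mul_zero, zero_add]
  have hcard : ((Finset.univ.erase m).card : ℝ) = (n : ℝ) - 1 := by
    rw [Finset.card_erase_of_mem (Finset.mem_univ m), Finset.card_univ, Fintype.card_fin,
      Nat.cast_sub (by omega), Nat.cast_one]
  have hdec := sum_slope_eq_erase hpe hμ hT₁ hT₂ hμm hTm
  rw [hcard, hw'] at h3 h4
  rw [← hw] at hdec
  rw [hdec] at h2
  have hg : ∀ k ∈ Finset.univ.erase m,
      fderiv ℝ φ x (e k) = ∑ i ∈ Finset.univ.erase m, p i * thirdDeriv u x e i i k := by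
    intro k hk
    rw [h1, herase, hTmm k (Finset.ne_of_mem_erase hk), mul_zero, zero_add]
  -- The radial derivative of `φ` is fixed by homogeneity and supplies the α²w² in |∇φ|².
  have hgm : fderiv ℝ φ x (e m) = -α * hessianFunction f u x := by
    rw [h1, hw, Finset.mul_sum]
    refine Finset.sum_congr rfl fun i _ => ?_
    rw [hTm, if_pos rfl]
    ring
  have hgrad : ‖∇ φ x‖ ^ 2 = α ^ 2 * hessianFunction f u x ^ 2
      + ∑ l ∈ Finset.univ.erase m, (∑ i ∈ Finset.univ.erase m, p i * thirdDeriv u x e i i l) ^ 2 := by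
    rw [norm_gradient_sq_eq_sum e, herase, hgm]
    congr 1
    · ring
    · exact Finset.sum_congr rfl fun l hl => by rw [hg l hl]
  have hn1 : (0 : ℝ) < (n : ℝ) - 1 := by
    have : (2 : ℝ) ≤ n := by exact_mod_cast hn
    linarith
  have h5 := mul_le_mul_of_nonneg_left h2 h4
  rw [hgrad, div_eq_mul_one_div (hessianFunction f u x ^ 2), hα]
  generalize hessianFunction f u x = w at *
  -- The radial terms 2/(n-1) and 2(n-2)/(n-1) add up to 2, exactly the 2α²w² coming from the
  -- removed index.
  have h6 : 2 / ((n : ℝ) - 1) * (α ^ 2 * w ^ 2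
      + ∑ l ∈ Finset.univ.erase m, (∑ i ∈ Finset.univ.erase m, p i * thirdDeriv u x e i i l) ^ 2)
      + 2 * (((n : ℝ) - 2) / ((n : ℝ) - 1)) * (w ^ 2 * α ^ 2)
      = (2 * ∑ l ∈ Finset.univ.erase m,
          (∑ i ∈ Finset.univ.erase m, p i * thirdDeriv u x e i i l) ^ 2
        + 2 * ((n : ℝ) - 1) * (α ^ 2 * w ^ 2)) / ((n : ℝ) - 1) := by
    field_simp
    ring
  rw [h6, div_le_iff₀ hn1]
  linarith

end HarmonicHessian

end

theorem theorem4p1 {n : ℕ} (hn : 1 ≤ n)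
    (Ω : Set (HarmonicHessian.E n)) (hΩ : IsOpen Ω)
    (u : HarmonicHessian.E n → ℝ) (hu : InnerProductSpace.HarmonicOnNhd u Ω)
    (f : (Fin n → ℝ) → ℝ) (hf_convex : ConvexOn ℝ Set.univ f)
    (hf_symm : HarmonicHessian.IsSymmetricFun f)
    (hf_hom : HarmonicHessian.IsHomogeneousOneOn f Set.univ) :
    HarmonicHessian.HoldsInViscositySense Ω (HarmonicHessian.hessianFunction f u)
      (fun _ w dw Lw => w * Lw ≥ 2 / (n : ℝ) * ‖dw‖ ^ 2) ∧
    (2 ≤ n → HarmonicHessian.IsHomogeneousOneOn u Ω →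
      HarmonicHessian.HoldsInViscositySense (Ω \ {0}) (HarmonicHessian.hessianFunction f u)
        (fun x w dw Lw => w * Lw ≥ 2 / ((n : ℝ) - 1) * ‖dw‖ ^ 2
          + 2 * (((n : ℝ) - 2) / ((n : ℝ) - 1)) * (w ^ 2 / ‖x‖ ^ 2))) := by
  have hcont : ContinuousOn (HarmonicHessian.hessianFunction f u) Ω := fun x hx =>
    (HarmonicHessian.continuousAt_hessianFunction hf_convex hf_symm hf_hom
      (hu x hx).1).continuousWithinAt
  refine ⟨⟨hcont, fun x hx φ hφ hφx hle => ?_⟩, fun hn2 huh =>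
    ⟨hcont.mono Set.sdiff_subset, fun x hx φ hφ hφx hle => ?_⟩⟩
  · exact HarmonicHessian.mul_laplacian_ge_of_touching hn hf_convex hf_symm hf_hom (hu x hx)
      hφ hφx hle
  · exact HarmonicHessian.mul_laplacian_ge_of_touching_of_homogeneous hn2 hf_convex hf_symm hf_hom
      hΩ hu huh hx.1 hx.2 hφ hφx hle
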